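/- Let $\beta>0$, $\Delta\in\mathbb R$, $d\in\mathbb N$, and let $G$ be a meromorphic function on $\mathbb C$ with only simple poles. Write $\rho(\omega)=\frac{G(\omega)-G(-\omega)}{2i}$ and let $\{\omega_n^+\}$ be the set of poles of $G$. Assume: 1. $G$ is holomorphic for $\operatorname{Im}\omega\ge 0$ (so $\operatorname{Im}\omega_n^+<0$), $\overline{G(\omega)}=G(-\overline\omega)$, and $\omega\rho(\omega)\ge 0$ for real $\omega$. 2. $\rho(\omega)\sim\omega^{2\Delta-d}$ as $\omega\to+\infty$ along the real axis, that is, $|\rho(\omega)|$ is bounded above and below by positive multiples of $\omega^{2\Delta-d}$ for all large $\omega$. 3. There are $C>0$ and radii $0<R_0'<R_1'<\dots\to\infty$ with $|G'(\omega)/G(\omega)|\le C/R_N'$ whenever $|\omega|=R_N'$ and $\operatorname{Im}\omega\ge 0$. 4. (Thermal product hypothesis.) $f(\omega)=\sinh(\beta\omega/2)/\rho(\omega)$ is an entire function of order one (for every $\epsilon>0$, $\ln|f(\omega)|<|\omega|^{1+\epsilon}$ for all large enough $|\omega|$), and its zeros are simple and all lie in $\{\pm\omega_n^+\}$. Let $0<R_0<R_1<\dots\to\infty$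 be any sequence for which there is $A>0$ with $\max_{|\omega|=R_N}|\rho(\omega)|<A R_N^{2\Delta-d}$ for all $N$, and let $\sum_n$ stand for $\lim_{N\to\infty}\sum_{|\omega_n^+|<R_N}$. Define $\mu$ by $G(\omega)=G(0)+\frac i2\mu\beta\omega+O(\omega^2)$ at $\omega=0$, and $\lambda=-\mu/G(0)$. Then the products $\prod_{m\ne n}\bigl[1-(\omega_n^+/\omega_m^+)^2\bigr]$ converge unconditionally to non-zero values, and: (a) If $2\Delta-d<1$, then $$\sum_n\frac{\sinh\frac{\beta\omega_n^+}{2}}{\omega_n^+\prod_{m\neq n}\bigl[1-(\omega_n^+/\omega_m^+)^2\bigr]}=\frac{\beta}{2}.$$ (b) If $2\Delta-d<0$ and $G$ has no polynomial contact term, i.e. $G(iy)\to 0$ as $y\to+\infty$, then $\lambda$ is finite and non-zero, and $$\sum_n\frac{\sinh\frac{\beta\omega_n^+}{2}}{\prod_{m\neq n}\bigl[1-(\omega_n^+/\omega_m^+)^2\bigr]}=\frac{i}{\lambda}.$$ The existence of both limits is part of the claim. -/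

import Mathlib

open Filter Topology Asymptotics

/-- The spectral density `ρ(ω) = (G(ω) - G(-ω)) / (2i)` of a retarded correlator `G`. -/
noncomputable def spectralDensity (G : ℂ → ℂ) (ω : ℂ) : ℂ :=
  (G ω - G (-ω)) / (2 * Complex.I)

/-- The spectrum of `G`: the set of its poles. -/
def spectrumOf (G : ℂ → ℂ) : Set ℂ :=
  {z | meromorphicOrderAt G z < 0}

/-- The poles of modulus less than `r`. -/
def spectrumInDisc (G : ℂ → ℂ) (r : ℝ) : Set ℂ :=
  {z | z ∈ spectrumOf G ∧ ‖z‖ < r}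

/-- A meromorphic function has finitely many poles in a disc, so that the finite sums over
`spectrumInDisc` used below are genuine sums. -/
theorem spectrumInDisc_finite {G : ℂ → ℂ} (hG : MeromorphicOn G Set.univ) (r : ℝ) :
    (spectrumInDisc G r).Finite := by
  have hb : MeromorphicOn G (Metric.closedBall 0 r) := fun z _ => hG z (Set.mem_univ z)
  refine ((MeromorphicOn.divisor G (Metric.closedBall 0 r)).finiteSupport
    (isCompact_closedBall 0 r)).subset ?_
  rintro z ⟨hz, hr⟩
  have hz' : meromorphicOrderAt G z < 0 := hz
  have hmem : z ∈ Metric.closedBall (0 : ℂ) r := by simpa using hr.le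
  rw [Function.mem_support, MeromorphicOn.divisor_apply hb hmem]
  intro h0
  rcases WithTop.untop₀_eq_zero.mp h0 with h | h
  · simp [h] at hz'
  · simp [h] at hz'

/-- A sequence of radii `0 < R₀ < R₁ < …` tending to infinity. -/
structure IsRadialSequence (R : ℕ → ℝ) : Prop where
  pos : ∀ N, 0 < R N
  strictMono : StrictMono R
  tendsto : Tendsto R atTop atTop

/-- The power-law bound `max_{|ω| = R_N} |ρ(ω)| < A R_N ^ (2Δ - d)`. A pole of `ρ` on one of the
circles is impossible, since `ρ` would be unbounded on that circle near the pole. -/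
def PowerLawBoundedOn (Δ : ℝ) (d : ℕ) (G : ℂ → ℂ) (R : ℕ → ℝ) : Prop :=
  ∃ A : ℝ, 0 < A ∧ ∀ N : ℕ, ∀ ω : ℂ, ‖ω‖ = R N →
    ‖spectralDensity G ω‖ < A * R N ^ (2 * Δ - d)

/-- An entire function of order one: holomorphic on `ℂ` and, for every `ε > 0`,
`ln |f(ω)| < |ω| ^ (1 + ε)` for all large enough `|ω|`. -/
structure IsEntireOfOrderOne (f : ℂ → ℂ) : Prop where
  differentiable : Differentiable ℂ f
  growth : ∀ ε : ℝ, 0 < ε → ∃ r : ℝ, ∀ ω : ℂ, r ≤ ‖ω‖ → ‖f ω‖ < Real.exp (‖ω‖ ^ (1 + ε))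

/-- The thermal product hypothesis: `sinh (βω/2) / ρ(ω)` is an entire function `f` of order one,
whose zeros are simple and lie at the points `±ω_n` of the spectrum and its mirror image.
The relation `f ρ = sinh` is imposed wherever neither `ω` nor `-ω` is a pole of `G`. -/
def ThermalProductHypothesis (β : ℝ) (G : ℂ → ℂ) : Prop :=
  ∃ f : ℂ → ℂ, IsEntireOfOrderOne f ∧
    (∀ ω : ℂ, ω ∉ spectrumOf G → -ω ∉ spectrumOf G →
      f ω * spectralDensity G ω = Complex.sinh (β * ω / 2)) ∧
    (∀ ω : ℂ, f ω = 0 → (ω ∈ spectrumOf G ∨ -ω ∈ spectrumOf G) ∧ deriv f ω ≠ 0)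

/-- Meromorphic retarded two-point functions `G(ω)`, at inverse temperature `β`, of a Hermitian
scalar operator of dimension `Δ` in `d` spacetime dimensions. -/
structure IsThermalCorrelator (β Δ : ℝ) (d : ℕ) (G : ℂ → ℂ) : Prop where
  /-- `G` is meromorphic on `ℂ`, with removable singularities removed (and value `0` at poles). -/
  meromorphic : MeromorphicNFOn G Set.univ
  /-- stability: `G` is holomorphic for `Im ω ≥ 0` -/
  retarded : ∀ ω : ℂ, 0 ≤ ω.im → AnalyticAt ℂ G ω
  /-- hermiticity of the operator -/
  hermitian : ∀ ω : ℂ, (starRingEnd ℂ) (G ω) = G (-(starRingEnd ℂ) ω)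
  /-- positivity: `ω ρ(ω) ≥ 0` on the real axis, where `ρ` is real by hermiticity -/
  positive : ∀ x : ℝ, 0 ≤ x * (spectralDensity G x).re
  /-- all poles are simple -/
  simple_poles : ∀ ω ∈ spectrumOf G, meromorphicOrderAt G ω = -1
  /-- operator product expansion: `ρ(ω) ~ ω ^ (2Δ - d)` for `ω → +∞` -/
  ope : (fun x : ℝ => spectralDensity G x) =Θ[atTop] (fun x : ℝ => x ^ (2 * Δ - d))
  /-- power-law behaviour of `G`: `|∂ ln G| ≤ C / R_N` on the arcs `|ω| = R_N`, `Im ω ≥ 0`, for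
  some sequence of radii. (Nothing is asked of the lower halves of the circles.) -/
  power_law : ∃ C : ℝ, 0 < C ∧ ∃ R : ℕ → ℝ, IsRadialSequence R ∧
    ∀ N : ℕ, ∀ ω : ℂ, ‖ω‖ = R N → 0 ≤ ω.im → ‖logDeriv G ω‖ ≤ C / R N
  thermal_product : ThermalProductHypothesis β G

/-- `G` carries no polynomial contact term: `G(ω) → 0` for `ω → i∞`. A non-zero polynomial
`g(ω²)` added to a function with this property destroys it. -/
def NoContactTerm (G : ℂ → ℂ) : Prop :=
  Tendsto (fun y : ℝ => G (y * Complex.I)) atTop (𝓝 0)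

/-- The constant `μ`, defined by `G(ω) = G(0) + (i/2) μ β ω + …` at `ω = 0`. -/
noncomputable def muOf (β : ℝ) (G : ℂ → ℂ) : ℂ :=
  2 * deriv G 0 / (Complex.I * β)

/-- The spectral parameter `λ = -μ / G(0)`. -/
noncomputable def lambdaOf (β : ℝ) (G : ℂ → ℂ) : ℂ :=
  -muOf β G / G 0

/-- The factors `1 - (z / w)²`, indexed by the poles `w ≠ z`. -/
noncomputable def mirrorFactor (G : ℂ → ℂ) (z : ℂ) (w : {w : ℂ // w ∈ spectrumOf G ∧ w ≠ z}) : ℂ :=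
  1 - (z / (w : ℂ)) ^ 2

/-- `∏_{w ≠ z} [1 - (z / w)²]`, the product over all poles `w` of `G` other than `z`. -/
noncomputable def mirrorProduct (G : ℂ → ℂ) (z : ℂ) : ℂ :=
  ∏' w, mirrorFactor G z w

/-! Let `f` be the entire function with `f ρ = sinh (β ω / 2)`. Since `ρ` and `sinh` are odd, `f` is
even, and its zeros are exactly the points `± ω_n`. Hence `f z = g (z ^ 2)` with `g` of order `1 /
2`, and Hadamard factorization in the variable `z ^ 2` expresses `deriv f a`, at a pole `a` of `G`,
as `-2 f 0 / a` times the mirror product. Comparing `f ρ` with `sinh` near `a`, where `ρ` has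
residue `res a / (2 i)`, turns each summand of (b) into `i f(0) res a / a` and each summand of (a)
into `i f(0) res a / a ^ 2`. Comparison at `0` gives `f(0) G'(0) = i β / 2`.

The partial sums are therefore sums of residues, and the residue theorem on `|z| = R_N` reduces both
claims to the decay of circle averages, of `G z / z` for (a) and of `G` for (b). For (a), averaging
over `z` and `-z` replaces `G` by `i ρ`, and the power-law bound on `ρ` suffices.

For (b), the same symmetry only reduces the average to the integral `I(r)` of `G` over the upper
half circle. Hermiticity makes `I` real, and `r I'(r) = -2 ρ(r)` together with positivity makes it
decreasing. On the radii `R_N'` the bound on the logarithmic derivative carries the decay of `G`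
from the imaginary axis to the whole arc, so `I(R_N') → 0`; monotonicity then gives `I(r) → 0` along
all radii, in particular along the unrelated sequence `R_N`. The same monotonicity shows `G(0) ≠ 0`,
so that `λ` is a genuine quotient. -/

/-! ### Hadamard factorization below order one -/

/-- A zero-free holomorphic function on a disc which is `1` at the centre has a holomorphic
logarithm vanishing at the centre. -/
theorem exists_log_of_ne_zero {h : ℂ → ℂ} {R : ℝ} (hR : 0 < R)
    (hd : DifferentiableOn ℂ h (Metric.ball 0 R)) (h0 : h 0 = 1)
    (hne : ∀ z ∈ Metric.ball (0 : ℂ) R, h z ≠ 0) :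
    ∃ L : ℂ → ℂ, DifferentiableOn ℂ L (Metric.ball 0 R) ∧ L 0 = 0 ∧
      ∀ z ∈ Metric.ball (0 : ℂ) R, Complex.exp (L z) = h z := by
  -- `L` is a primitive of `h' / h`; then `h * exp (-L)` has derivative zero and is constant on the
  -- disc.
  have hd' : DifferentiableOn ℂ (fun z => deriv h z / h z) (Metric.ball 0 R) :=
    (hd.deriv Metric.isOpen_ball).div hd hne
  obtain ⟨L, hL0, hL⟩ := (hd'.isExactOn_ball).with_val_at 0 0
  have h0mem : (0 : ℂ) ∈ Metric.ball (0 : ℂ) R := Metric.mem_ball_self hR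
  refine ⟨L, fun z hz => (hL z hz).differentiableAt.differentiableWithinAt, hL0, fun z hz => ?_⟩
  have hq : ∀ w ∈ Metric.ball (0 : ℂ) R,
      HasDerivWithinAt (fun w => h w * Complex.exp (-L w)) 0 (Metric.ball 0 R) w := by
    intro w hw
    have h1 := (hd.differentiableAt (Metric.isOpen_ball.mem_nhds hw)).hasDerivAt
    have h2 := h1.fun_mul (hL w hw).fun_neg.cexp
    refine HasDerivAt.hasDerivWithinAt ?_
    have h3 : deriv h w * Complex.exp (-L w) +
        h w * (Complex.exp (-L w) * -(deriv h w / h w)) = 0 := by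
      have := hne w hw
      field_simp
      ring
    rw [h3] at h2
    exact h2
  have hc := (convex_ball (0 : ℂ) R).norm_image_sub_le_of_norm_hasDerivWithin_le (C := 0) hq
    (by simp) h0mem hz
  have hc' : h z * Complex.exp (-L z) = 1 := by
    simpa [hL0, h0, sub_eq_zero] using hc
  rw [Complex.exp_neg] at hc'
  have := Complex.exp_ne_zero (L z)
  field_simp at hc'
  exact hc'.symm

/-- Borel–Carathéodory for zero-free functions. -/
theorem exists_exp_eq_and_norm_le {h : ℂ → ℂ} {R A : ℝ} (hR : 0 < R) (hA : 0 < A)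
    (hd : DifferentiableOn ℂ h (Metric.ball 0 R)) (h0 : h 0 = 1)
    (hne : ∀ z ∈ Metric.ball (0 : ℂ) R, h z ≠ 0)
    (hb : ∀ z ∈ Metric.ball (0 : ℂ) R, ‖h z‖ ≤ Real.exp A) {z : ℂ}
    (hz : z ∈ Metric.ball (0 : ℂ) R) :
    ∃ l : ℂ, Complex.exp l = h z ∧ ‖l‖ ≤ 2 * A * ‖z‖ / (R - ‖z‖) := by
  obtain ⟨L, hLd, hL0, hL⟩ := exists_log_of_ne_zero hR hd h0 hne
  refine ⟨L z, hL z hz, Complex.borelCaratheodory_zero hA hLd (fun w hw => ?_) hR hz hL0⟩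
  have := hb w hw
  rw [← hL w hw, Complex.norm_exp, Real.exp_le_exp] at this
  exact this

/-- Dividing an entire function by the factors belonging to finitely many simple zeros. -/
theorem exists_entire_eq_mul_prod {ι : Type*} {g : ℂ → ℂ} (hg : Differentiable ℂ g) {b : ι → ℂ}
    (hinj : Function.Injective b) (hb0 : ∀ i, b i ≠ 0) (hz : ∀ i, g (b i) = 0) (S : Finset ι) :
    ∃ h : ℂ → ℂ, Differentiable ℂ h ∧ ∀ w, g w = h w * ∏ i ∈ S, (1 - w / b i) := by
  classical
  induction S using Finset.induction_on with
  | empty => exact ⟨g, hg, by simp⟩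
  | insert a S ha ih =>
    obtain ⟨h, hh, he⟩ := ih
    have hza : h (b a) = 0 := by
      have := he (b a)
      rw [hz a] at this
      rcases mul_eq_zero.mp this.symm with h1 | h1
      · exact h1
      · obtain ⟨i, hi, h2⟩ := Finset.prod_eq_zero_iff.mp h1
        rw [sub_eq_zero, eq_comm, div_eq_one_iff_eq (hb0 i)] at h2
        exact absurd (hinj h2) (by rintro rfl; exact ha hi)
    -- At a zero `b`, `h w = (w - b) * dslope h b w`, and `w - b = -b * (1 - w / b)`.
    refine ⟨fun w => -b a * dslope h (b a) w, ?_, fun w => ?_⟩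
    · refine (differentiable_const _).mul ?_
      rw [← differentiableOn_univ, Complex.differentiableOn_dslope univ_mem]
      exact hh.differentiableOn
    · rw [Finset.prod_insert ha, he w]
      have h1 : (w - b a) * dslope h (b a) w = h w := by
        have := sub_smul_dslope h (b a) w
        simpa [hza] using this
      rw [← h1]
      have := hb0 a
      field_simp
      ring

/-- Dyadic decomposition: the shell `c i ≈ R₀ 2 ^ n` has at most a multiple of `2 ^ (n σ)` members,
each contributing about `2 ^ (-n)`, and `σ < 1` makes the resulting series geometric. -/
theorem summable_inv_of_card_le {ι : Type*} {c : ι → ℝ} (hc : ∀ i, 0 < c i) {K σ R₀ : ℝ}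
    (hσ : σ < 1) (hR₀ : 0 < R₀)
    (hcard : ∀ R, R₀ ≤ R → ∀ S : Finset ι, (∀ i ∈ S, c i ≤ R) → (S.card : ℝ) ≤ K * R ^ σ) :
    Summable fun i => (c i)⁻¹ := by
  classical
  have hex : ∀ i, ∃ k : ℕ, c i ≤ R₀ * 2 ^ k := fun i => by
    obtain ⟨k, hk⟩ := pow_unbounded_of_one_lt (c i / R₀) (one_lt_two)
    exact ⟨k, by rw [mul_comm]; exact ((div_lt_iff₀ hR₀).mp hk).le⟩
  let k : ι → ℕ := fun i => Nat.find (hex i)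
  have hk1 : ∀ i, c i ≤ R₀ * 2 ^ k i := fun i => Nat.find_spec (hex i)
  have hfin : {i | c i ≤ R₀}.Finite := by
    by_contra hinf
    obtain ⟨S, hS, hcS⟩ := Set.Infinite.exists_subset_card_eq hinf (⌊K * R₀ ^ σ⌋₊ + 1)
    have h1 := hcard R₀ le_rfl S (fun i hi => hS hi)
    rw [hcS] at h1
    have := Nat.lt_floor_add_one (K * R₀ ^ σ)
    push_cast at h1
    linarith
  -- Outside the innermost shell, minimality of `k i` bounds `c i` below by `R₀ 2 ^ (k i - 1)`. The
  -- innermost shell has no such bound, but it is finite.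
  obtain ⟨D, hD⟩ : ∃ D : ℝ, ∀ i, (c i)⁻¹ ≤ D * ((2 : ℝ) ^ k i)⁻¹ := by
    obtain ⟨M, hM⟩ := (hfin.image (fun i => (c i)⁻¹)).bddAbove
    refine ⟨max M (2 / R₀), fun i => ?_⟩
    by_cases hi : k i = 0
    · have h1 : c i ≤ R₀ := by simpa [hi] using hk1 i
      rw [hi]
      simpa using Or.inl (hM (Set.mem_image_of_mem _ h1))
    · have h1 : ¬ c i ≤ R₀ * 2 ^ (k i - 1) := Nat.find_min (hex i) (Nat.pred_lt hi)
      rw [not_le] at h1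
      have h2 : (2 : ℝ) ^ k i = 2 * 2 ^ (k i - 1) := by
        rw [← pow_succ', Nat.sub_add_cancel (Nat.one_le_iff_ne_zero.mpr hi)]
      calc (c i)⁻¹ ≤ (R₀ * 2 ^ (k i - 1))⁻¹ := by
            apply inv_anti₀ (by positivity) h1.le
        _ = 2 / R₀ * ((2 : ℝ) ^ k i)⁻¹ := by rw [h2]; field_simp
        _ ≤ _ := by gcongr; exact le_max_right _ _
  have hgeo : Summable fun n : ℕ => (K * R₀ ^ σ) * ((2 : ℝ) ^ (σ - 1)) ^ n := by
    refine (summable_geometric_of_lt_one (by positivity) ?_).mul_left _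
    exact Real.rpow_lt_one_of_one_lt_of_neg one_lt_two (by linarith)
  have hfib : ∀ (S : Finset ι) (n : ℕ), ((S.filter fun i => k i = n).card : ℝ) * ((2 : ℝ) ^ n)⁻¹ ≤
      (K * R₀ ^ σ) * ((2 : ℝ) ^ (σ - 1)) ^ n := by
    intro S n
    have h1 := hcard (R₀ * 2 ^ n) (le_mul_of_one_le_right hR₀.le (one_le_pow₀ one_le_two))
      (S.filter fun i => k i = n) (fun i hi => by
        have := hk1 i
        rwa [(Finset.mem_filter.mp hi).2] at this)
    calc _ ≤ K * (R₀ * 2 ^ n) ^ σ * ((2 : ℝ) ^ n)⁻¹ := by gcongr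
      _ = _ := by
        rw [Real.mul_rpow hR₀.le (by positivity), ← Real.rpow_natCast, ← Real.rpow_natCast,
          ← Real.rpow_mul (by norm_num), ← Real.rpow_mul (by norm_num),
          mul_comm (n : ℝ) σ, sub_mul, one_mul, Real.rpow_sub two_pos]
        ring
  have hsum : Summable fun i => ((2 : ℝ) ^ k i)⁻¹ := by
    refine summable_of_sum_le (c := ∑' n : ℕ, (K * R₀ ^ σ) * ((2 : ℝ) ^ (σ - 1)) ^ n)
      (fun i => by positivity) fun S => ?_
    rw [← Finset.sum_fiberwise_of_maps_to (s := S) (t := S.image k) (g := k)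
      (fun i hi => Finset.mem_image_of_mem k hi)]
    calc _ ≤ ∑ n ∈ S.image k, (K * R₀ ^ σ) * ((2 : ℝ) ^ (σ - 1)) ^ n := by
          refine Finset.sum_le_sum fun n _ => ?_
          refine le_trans (le_of_eq ?_) (hfib S n)
          rw [Finset.sum_congr rfl (g := fun _ => ((2 : ℝ) ^ n)⁻¹)
            (fun i hi => by rw [(Finset.mem_filter.mp hi).2])]
          simp
      _ ≤ _ := hgeo.sum_le_tsum _ (fun n _ => le_trans (by positivity) (hfib ∅ n))
  exact (hsum.mul_left D).of_nonneg_of_le (fun i => (inv_pos.mpr (hc i)).le) hD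

/-- **Hadamard factorization** for entire functions of order less than one with simple zeros. -/
theorem multipliable_and_eq_mul_tprod_of_order_lt_one {ι : Type*} {g : ℂ → ℂ}
    (hg : Differentiable ℂ g) (hg0 : g 0 ≠ 0) {σ r : ℝ} (hσ0 : 0 < σ) (hσ : σ < 1)
    (hgrow : ∀ w, r ≤ ‖w‖ → ‖g w‖ ≤ Real.exp (‖w‖ ^ σ))
    {b : ι → ℂ} (hinj : Function.Injective b) (hz : ∀ w, g w = 0 ↔ ∃ i, b i = w)
    (hsimple : ∀ w, g w = 0 → deriv g w ≠ 0) (w : ℂ) :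
    Multipliable (fun i => 1 - w / b i) ∧ g w = g 0 * ∏' i, (1 - w / b i) := by
  classical
  have hzb : ∀ i, g (b i) = 0 := fun i => (hz _).mpr ⟨i, rfl⟩
  have hb0 : ∀ i, b i ≠ 0 := fun i h => hg0 (h ▸ hzb i)
  choose h hh he using exists_entire_eq_mul_prod hg hinj hb0 hzb
  have hh0 : ∀ S, h S 0 = g 0 := fun S => by simpa using (he S 0).symm
  -- The logarithm absorbs the normalization by `g 0`; the extra `1` keeps `A` positive, as
  -- Borel–Carathéodory requires.
  set A : ℝ → ℝ := fun R => (3 * R) ^ σ + (|Real.log ‖g 0‖| + 1) with hA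
  have hApos : ∀ R, 0 < R → 0 < A R := fun R hR => by positivity
  -- the maximum principle on the circle of radius `3 R`
  have hmax : ∀ (R : ℝ), 0 < R → r ≤ 3 * R → ∀ S : Finset ι, (∀ i ∈ S, ‖b i‖ ≤ R) →
      ∀ z, ‖z‖ ≤ 3 * R → ‖h S z / g 0‖ * 2 ^ S.card ≤ Real.exp (A R) := by
    intro R hR hrR S hS z hzR
    have key : ∀ u ∈ frontier (Metric.ball (0 : ℂ) (3 * R)),
        ‖h S u‖ ≤ Real.exp ((3 * R) ^ σ) / 2 ^ S.card := by
      intro u hu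
      rw [frontier_ball _ (by positivity)] at hu
      have hu' : ‖u‖ = 3 * R := by simpa using hu
      have h1 := hgrow u (by rw [hu']; exact hrR)
      rw [he S u, norm_mul, hu'] at h1
      have h2 : (2 : ℝ) ^ S.card ≤ ‖∏ i ∈ S, (1 - u / b i)‖ := by
        rw [norm_prod]
        rw [← Finset.prod_const]
        refine Finset.prod_le_prod (fun _ _ => by norm_num) fun i hi => ?_
        have h3 : 3 ≤ ‖u / b i‖ := by
          rw [norm_div, hu', le_div_iff₀ (norm_pos_iff.mpr (hb0 i))]
          linarith [hS i hi]
        have h4 := norm_sub_norm_le (u / b i) 1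
        rw [norm_one, norm_sub_rev] at h4
        linarith
      rw [le_div_iff₀ (by positivity)]
      exact (mul_le_mul_of_nonneg_left h2 (norm_nonneg _)).trans h1
    have h5 := Complex.norm_le_of_forall_mem_frontier_norm_le Metric.isBounded_ball
      ((hh S).diffContOnCl) key
      (z := z) (by rw [closure_ball _ (by positivity)]; simpa using hzR)
    rw [norm_div]
    have hgpos : 0 < ‖g 0‖ := norm_pos_iff.mpr hg0
    calc ‖h S z‖ / ‖g 0‖ * 2 ^ S.card
        ≤ Real.exp ((3 * R) ^ σ) / 2 ^ S.card / ‖g 0‖ * 2 ^ S.card := by gcongr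
      _ = Real.exp ((3 * R) ^ σ) * ‖g 0‖⁻¹ := by field_simp
      _ = Real.exp ((3 * R) ^ σ) * Real.exp (-Real.log ‖g 0‖) := by
          rw [Real.exp_neg, Real.exp_log hgpos]
      _ ≤ Real.exp (A R) := by
          rw [← Real.exp_add, hA]
          gcongr
          linarith [neg_abs_le (Real.log ‖g 0‖)]
  set R₀ : ℝ := max 1 r with hR₀
  have hR₀1 : ∀ R, R₀ ≤ R → 1 ≤ R ∧ 0 < R ∧ r ≤ 3 * R := fun R hR => by
    have h1 : 1 ≤ R := (le_max_left _ _).trans hR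
    have h2 : r ≤ R := (le_max_right _ _).trans hR
    exact ⟨h1, by linarith, by linarith⟩
  -- At the centre the quotient `h S / g 0` is `1`, so the previous bound reads `2 ^ card ≤ exp (A
  -- R)`. This takes the place of Jensen's formula.
  have hcard : ∀ R, R₀ ≤ R → ∀ S : Finset ι, (∀ i ∈ S, ‖b i‖ ≤ R) →
      (S.card : ℝ) ≤ ((3 ^ σ + (|Real.log ‖g 0‖| + 1)) / Real.log 2) * R ^ σ := by
    intro R hR S hS
    obtain ⟨h1, h2, h3⟩ := hR₀1 R hR
    have h4 := hmax R h2 h3 S hS 0 (by simp; positivity)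
    rw [hh0, div_self hg0, norm_one, one_mul, ← Real.rpow_natCast,
      Real.rpow_def_of_pos two_pos, Real.exp_le_exp] at h4
    have hl : 0 < Real.log 2 := Real.log_pos one_lt_two
    have h5 : A R ≤ (3 ^ σ + (|Real.log ‖g 0‖| + 1)) * R ^ σ := by
      rw [hA, add_mul]
      simp only
      rw [Real.mul_rpow (by norm_num) h2.le]
      gcongr
      exact le_mul_of_one_le_right (by positivity) (Real.one_le_rpow h1 hσ0.le)
    rw [div_mul_eq_mul_div, le_div_iff₀ hl, mul_comm]
    exact h4.trans h5
  have hsum : Summable fun i => ‖b i‖⁻¹ :=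
    summable_inv_of_card_le (fun i => norm_pos_iff.mpr (hb0 i)) hσ
      (lt_of_lt_of_le one_pos (le_max_left 1 r)) hcard
  have hmul : Multipliable (fun i => 1 - w / b i) := by
    have : Summable fun i => ‖-(w / b i)‖ := by
      simpa [div_eq_mul_inv] using hsum.mul_left ‖w‖
    simpa [sub_eq_add_neg] using multipliable_one_add_of_summable this
  refine ⟨hmul, ?_⟩
  have hfin : ∀ n : ℕ, {i | ‖b i‖ ≤ n}.Finite := fun n => by
    have h1 := hsum.tendsto_cofinite_zero.eventually_lt_const
      (show (0 : ℝ) < ((n : ℝ) + 1)⁻¹ by positivity)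
    refine (Filter.eventually_cofinite.mp h1).subset fun i hi => ?_
    simp only [Set.mem_ofPred_eq, not_lt] at hi ⊢
    exact inv_anti₀ (norm_pos_iff.mpr (hb0 i)) (by linarith)
  let T : ℕ → Finset ι := fun n => (hfin n).toFinset
  have hT : Tendsto T atTop atTop := by
    refine tendsto_atTop_finset_of_monotone (fun m n hmn i hi => ?_) fun i => ?_
    · simp only [T, Set.Finite.mem_toFinset, Set.mem_ofPred_eq] at hi ⊢
      exact hi.trans (by exact_mod_cast hmn)
    · obtain ⟨n, hn⟩ := exists_nat_ge ‖b i‖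
      exact ⟨n, by simpa [T] using hn⟩
  have hprod : Tendsto (fun n => ∏ i ∈ T n, (1 - w / b i)) atTop (𝓝 (∏' i, (1 - w / b i))) :=
    hmul.hasProd.comp hT
  -- With all zeros of modulus at most `n` divided out, the quotient is zero-free on the disc of
  -- radius `n`, so its logarithm at `w` is `O(n ^ (σ - 1))`.
  have hlim : Tendsto (fun n => h (T n) w) atTop (𝓝 (g 0)) := by
    have hev : ∀ᶠ n : ℕ in atTop, R₀ ≤ n ∧ ‖w‖ < n :=
      (tendsto_natCast_atTop_atTop.eventually_ge_atTop R₀).and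
        (tendsto_natCast_atTop_atTop.eventually_gt_atTop ‖w‖)
    have hl : ∀ n : ℕ, ∃ l : ℂ, (R₀ ≤ n ∧ ‖w‖ < n) →
        Complex.exp l = h (T n) w / g 0 ∧ ‖l‖ ≤ 2 * A n * ‖w‖ / (n - ‖w‖) := by
      intro n
      by_cases hn : R₀ ≤ n ∧ ‖w‖ < n
      · obtain ⟨h1, h2, h3⟩ := hR₀1 n hn.1
        have hTn : ∀ i ∈ T n, ‖b i‖ ≤ n := fun i hi => by simpa [T] using hi
        obtain ⟨l, hl⟩ := exists_exp_eq_and_norm_le (h := fun z => h (T n) z / g 0) h2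
          (hApos n h2) ((hh _).div_const _).differentiableOn (by simp [hh0, hg0])
          (fun z hzn => by
            refine div_ne_zero (fun h0 => ?_) hg0
            -- A zero of the quotient in the disc would be some `b i` with `i ∈ T n`, where the
            -- product vanishes too; `g` would then have a double zero.
            have hgz : g z = 0 := by rw [he (T n) z, h0, zero_mul]
            obtain ⟨i, rfl⟩ := (hz z).mp hgz
            have hi : i ∈ T n := by
              have : ‖b i‖ < n := by simpa using hzn
              simpa [T] using this.le
            have hP : ∏ j ∈ T n, (1 - b i / b j) = 0 :=
              Finset.prod_eq_zero hi (by rw [div_self (hb0 i), sub_self])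
            refine hsimple _ hgz ?_
            have hf : g = fun z => h (T n) z * ∏ j ∈ T n, (1 - z / b j) := funext (he (T n))
            have hPd : DifferentiableAt ℂ (fun z => ∏ j ∈ T n, (1 - z / b j)) (b i) := by
              fun_prop
            rw [hf, deriv_fun_mul (hh _ _) hPd, h0, hP]
            simp)
          (fun z hzn => by
            have hzn' : ‖z‖ < n := by simpa using hzn
            have h4 := hmax n h2 h3 (T n) hTn z (by linarith)
            exact (le_mul_of_one_le_right (norm_nonneg _) (one_le_pow₀ one_le_two)).trans h4)
          (z := w) (by simpa using hn.2)
        exact ⟨l, fun _ => hl⟩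
      · exact ⟨0, fun h => absurd h hn⟩
    choose l hl using hl
    have hl0 : Tendsto l atTop (𝓝 0) := by
      have hbd : Tendsto (fun x : ℝ => 2 * A x * ‖w‖ / (x - ‖w‖)) atTop (𝓝 0) := by
        have e1 : Tendsto (fun x : ℝ => x ^ (-(1 - σ))) atTop (𝓝 0) :=
          tendsto_rpow_neg_atTop (by linarith)
        have e2 : Tendsto (fun x : ℝ => x⁻¹) atTop (𝓝 0) := tendsto_inv_atTop_zero
        have e3 : Tendsto (fun x : ℝ => 2 * ‖w‖ * (3 ^ σ * x ^ (-(1 - σ)) +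
            (|Real.log ‖g 0‖| + 1) * x⁻¹) / (1 - ‖w‖ * x⁻¹)) atTop
            (𝓝 (2 * ‖w‖ * (3 ^ σ * 0 + (|Real.log ‖g 0‖| + 1) * 0) / (1 - ‖w‖ * 0))) :=
          (((e1.const_mul _).add (e2.const_mul _)).const_mul _).div
            ((e2.const_mul _).const_sub 1) (by simp)
        simp only [mul_zero, add_zero, zero_div] at e3
        refine e3.congr' ?_
        filter_upwards [eventually_gt_atTop 0, eventually_gt_atTop ‖w‖] with x hx hxw
        have h6 : x ^ (-(1 - σ)) = x ^ σ * x⁻¹ := by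
          rw [show -(1 - σ) = σ + (-1) by ring, Real.rpow_add hx, Real.rpow_neg_one]
        have h7 : x - ‖w‖ ≠ 0 := by linarith
        have h8 : 1 - ‖w‖ * x⁻¹ = (x - ‖w‖) * x⁻¹ := by field_simp
        rw [hA, h6, h8]
        simp only
        rw [Real.mul_rpow (by norm_num) hx.le]
        field_simp
      refine squeeze_zero_norm' ?_ (hbd.comp tendsto_natCast_atTop_atTop)
      filter_upwards [hev] with n hn using (hl n hn).2
    have hexp : Tendsto (fun n => g 0 * Complex.exp (l n)) atTop (𝓝 (g 0 * Complex.exp 0)) :=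
      ((Complex.continuous_exp.tendsto 0).comp hl0).const_mul _
    rw [Complex.exp_zero, mul_one] at hexp
    refine hexp.congr' ?_
    filter_upwards [hev] with n hn
    rw [(hl n hn).1]
    field_simp
  have hconst : Tendsto (fun _ : ℕ => g w) atTop (𝓝 (g 0 * ∏' i, (1 - w / b i))) :=
    (hlim.mul hprod).congr fun n => (he (T n) w).symm
  exact tendsto_nhds_unique tendsto_const_nhds hconst

/-! ### Even entire functions -/

/-- An even entire function is an entire function of the square. -/
theorem exists_entire_comp_sq_of_even {f : ℂ → ℂ} (hf : Differentiable ℂ f)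
    (heven : ∀ z, f (-z) = f z) : ∃ g : ℂ → ℂ, Differentiable ℂ g ∧ ∀ z, f z = g (z ^ 2) := by
  let s : ℂ → ℂ := fun w => w ^ ((2 : ℂ)⁻¹)
  have hs : ∀ w, s w ^ 2 = w := fun w => by
    exact_mod_cast Complex.cpow_nat_inv_pow w (n := 2) two_ne_zero
  have hfs : ∀ w z, z ^ 2 = w → f (s w) = f z := fun w z hz => by
    rcases sq_eq_sq_iff_eq_or_eq_neg.mp ((hs w).trans hz.symm) with h | h
    · rw [h]
    · rw [h, heven]
  refine ⟨fun w => f (s w), ?_, fun z => (hfs _ z rfl).symm⟩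
  have hne : ∀ w₀ : ℂ, w₀ ≠ 0 → DifferentiableAt ℂ (fun w => f (s w)) w₀ := by
    intro w₀ h0
    -- The branch `s` jumps across the cut, but evenness allows any other square root of `w`. This
    -- one is holomorphic near `w₀`, because `w / w₀` stays close to `1`.
    have heq : (fun w => f (s w)) = fun w => f (s w₀ * (w / w₀) ^ ((2 : ℂ)⁻¹)) := by
      funext w
      refine hfs _ _ ?_
      have h1 : ((w / w₀) ^ ((2 : ℂ)⁻¹)) ^ 2 = w / w₀ := hs _
      rw [mul_pow, hs, h1]
      field_simp
    rw [heq]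
    refine (hf _).comp w₀ ((differentiableAt_const _).mul ?_)
    refine DifferentiableAt.cpow (by fun_prop) (by fun_prop) ?_
    rw [div_self h0]
    exact Complex.one_mem_slitPlane
  -- At the branch point continuity is enough, by removability of the singularity.
  have hcont : ContinuousAt (fun w => f (s w)) 0 := by
    have hs0 : s 0 = 0 := by simp [s]
    have : ContinuousAt s 0 := by
      rw [ContinuousAt, hs0, tendsto_zero_iff_norm_tendsto_zero]
      have h1 : ∀ w, ‖s w‖ = Real.sqrt ‖w‖ := fun w => by
        rw [eq_comm, Real.sqrt_eq_iff_eq_sq (norm_nonneg _) (norm_nonneg _), ← norm_pow, hs]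
      simp_rw [h1]
      have : Continuous fun w : ℂ => Real.sqrt ‖w‖ := by fun_prop
      simpa using this.tendsto 0
    exact (hf.continuous.continuousAt).comp this
  rw [← differentiableOn_univ,
    ← Complex.differentiableOn_compl_singleton_and_continuousAt_iff (c := 0) univ_mem]
  exact ⟨fun w hw => (hne w hw.2).differentiableWithinAt, hcont⟩

/-! ### Residues through circle averages -/

/-- Write `(z - a)⁻¹ = a⁻¹ (z / (z - a) - 1)`; the average of `z / (z - a)` is `1` by Cauchy's
formula. -/
theorem circleAverage_inv_sub_eq_zero {R : ℝ} {a : ℂ} (ha0 : a ≠ 0)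
    (ha : a ∈ Metric.ball (0 : ℂ) R) :
    Real.circleAverage (fun z => (z - a)⁻¹) 0 R = 0 := by
  have hR : 0 < R := Metric.pos_of_mem_ball ha
  have hi : CircleIntegrable (fun z => z / (z - a)) 0 R := by
    refine ContinuousOn.circleIntegrable hR.le (continuousOn_id.div (by fun_prop) fun z hz h => ?_)
    rw [sub_eq_zero] at h
    subst h
    simp only [mem_sphere_iff_norm, Metric.mem_ball, dist_zero_right, sub_zero] at hz ha
    exact ha.ne hz
  have h1 : Real.circleAverage (fun z => z / (z - a)) 0 R = 1 := by
    have := (diffContOnCl_const (c := (1 : ℂ)) (𝕜 := ℂ)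
      (s := Metric.ball (0 : ℂ) |R|)).circleAverage_smul_div (w := a) (by rwa [abs_of_pos hR])
    simpa using this
  have h2 : Set.EqOn (fun z => (z - a)⁻¹) (fun z => a⁻¹ • (z / (z - a) - 1))
      (Metric.sphere 0 |R|) := by
    intro z hz
    have hza : z - a ≠ 0 := fun h => by
      rw [sub_eq_zero] at h
      subst h
      rw [abs_of_pos hR] at hz
      simp only [mem_sphere_iff_norm, Metric.mem_ball, dist_zero_right, sub_zero] at hz ha
      exact ha.ne hz
    simp only [smul_eq_mul]
    field_simp
    ring
  rw [Real.circleAverage_congr_sphere h2, Real.circleAverage_fun_smul,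
    Real.circleAverage_fun_sub hi (circleIntegrable_const _ _ _), h1, Real.circleAverage_const]
  simp

theorem circleAverage_div_eq_deriv {h : ℂ → ℂ} {R : ℝ} (hR : 0 < R)
    (hh : ∀ z ∈ Metric.closedBall (0 : ℂ) R, AnalyticAt ℂ h z) :
    Real.circleAverage (fun z => h z / z) 0 R = deriv h 0 := by
  rw [Real.circleAverage_eq_circleIntegral hR.ne']
  have := Complex.two_pi_I_inv_smul_circleIntegral_sub_sq_inv_smul_of_differentiable
    (isOpen_analyticAt ℂ h) (c := 0) (w₀ := 0) (R := R) (f := h) hh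
    (fun z hz => (AnalyticAt.differentiableAt hz).differentiableWithinAt) (Metric.mem_ball_self hR)
  rw [← this]
  congr 2
  funext z
  simp only [sub_zero, smul_eq_mul]
  rw [div_eq_mul_inv, sq, mul_inv]
  ring

theorem circleAverage_inv_sub_div_eq_zero {R : ℝ} {a : ℂ} (ha0 : a ≠ 0)
    (ha : a ∈ Metric.ball (0 : ℂ) R) :
    Real.circleAverage (fun z => (z - a)⁻¹ / z) 0 R = 0 := by
  have hR : 0 < R := Metric.pos_of_mem_ball ha
  have hne : ∀ z ∈ Metric.sphere (0 : ℂ) R, z ≠ 0 ∧ z - a ≠ 0 := fun z hz => by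
    simp only [mem_sphere_iff_norm, Metric.mem_ball, dist_zero_right, sub_zero] at hz ha
    refine ⟨fun h => ?_, fun h => ?_⟩
    · rw [h, norm_zero] at hz; exact hR.ne hz
    · rw [sub_eq_zero] at h; rw [h] at hz; exact ha.ne hz
  have h1 : Real.circleAverage (fun z : ℂ => 1 / z) 0 R = 0 := by
    simpa using circleAverage_div_eq_deriv (h := fun _ => 1) hR fun z _ => analyticAt_const
  have h2 : Set.EqOn (fun z => (z - a)⁻¹ / z) (fun z => a⁻¹ • ((z - a)⁻¹ - 1 / z))
      (Metric.sphere 0 |R|) := by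
    intro z hz
    rw [abs_of_pos hR] at hz
    obtain ⟨h3, h4⟩ := hne z hz
    simp only [smul_eq_mul]
    field_simp
    ring
  have hi1 : CircleIntegrable (fun z => (z - a)⁻¹) 0 R :=
    ContinuousOn.circleIntegrable hR.le (ContinuousOn.inv₀ (by fun_prop) fun z hz => (hne z hz).2)
  have hi2 : CircleIntegrable (fun z : ℂ => 1 / z) 0 R :=
    ContinuousOn.circleIntegrable hR.le
      (continuousOn_const.div continuousOn_id fun z hz => (hne z hz).1)
  rw [Real.circleAverage_congr_sphere h2, Real.circleAverage_fun_smul,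
    Real.circleAverage_fun_sub hi1 hi2, h1, circleAverage_inv_sub_eq_zero ha0 ha]
  simp

/-- Removing the principal parts at finitely many simple poles. -/
theorem exists_analytic_eq_sub_principal_parts {G : ℂ → ℂ} {U : Set ℂ} {P : Finset ℂ}
    {res : ℂ → ℂ} (hres : ∀ a ∈ P, Tendsto (fun z => (z - a) * G z) (𝓝[≠] a) (𝓝 (res a)))
    (hpunct : ∀ a ∈ P, ∀ᶠ z in 𝓝[≠] a, AnalyticAt ℂ G z)
    (han : ∀ z ∈ U, z ∉ P → AnalyticAt ℂ G z) :
    ∃ h : ℂ → ℂ, (∀ z ∈ U, AnalyticAt ℂ h z) ∧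
      ∀ z, AnalyticAt ℂ G z → z ∉ P → h z = G z - ∑ a ∈ P, res a * (z - a)⁻¹ := by
  classical
  set F : ℂ → ℂ := fun z => G z - ∑ a ∈ P, res a * (z - a)⁻¹ with hF
  have hsum : ∀ (Q : Finset ℂ) z, z ∉ Q →
      AnalyticAt ℂ (fun z => ∑ a ∈ Q, res a * (z - a)⁻¹) z := fun Q z hz => by
    refine Finset.analyticAt_fun_sum _ fun a ha => ?_
    refine analyticAt_const.mul (AnalyticAt.inv (by fun_prop) ?_)
    rw [sub_ne_zero]
    rintro rfl
    exact hz ha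
  have hFan : ∀ z, AnalyticAt ℂ G z → z ∉ P → AnalyticAt ℂ F z := fun z hz hzP =>
    hz.sub (hsum P z hzP)
  -- Taking punctured limits everywhere repairs all the removable singularities by one formula.
  let h : ℂ → ℂ := fun z => limUnder (𝓝[≠] z) F
  have hhF : ∀ z, AnalyticAt ℂ F z → h z = F z := fun z hz =>
    (hz.continuousAt.tendsto.mono_left nhdsWithin_le_nhds).limUnder_eq
  refine ⟨h, fun z hz => ?_, fun z hz hzP => hhF z (hFan z hz hzP)⟩
  by_cases hzP : z ∈ P
  · have hd : ∀ᶠ y in 𝓝[≠] z, AnalyticAt ℂ F y := by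
      have h1 : ∀ᶠ y in 𝓝[≠] z, y ∉ P.erase z := by
        refine nhdsWithin_le_nhds ?_
        exact (P.erase z).finite_toSet.isClosed.isOpen_compl.mem_nhds (by simp)
      filter_upwards [hpunct z hzP, h1, self_mem_nhdsWithin] with y hy hy1 hy2
      exact hFan y hy fun h => hy1 (Finset.mem_erase.mpr ⟨hy2, h⟩)
    have ho : Tendsto (fun y => (y - z) * F y) (𝓝[≠] z) (𝓝 0) := by
      have h2 : Tendsto (fun y => ((y - z) * G y - res z) -
          (y - z) * ∑ a ∈ P.erase z, res a * (y - a)⁻¹) (𝓝[≠] z)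
          (𝓝 ((res z - res z) - (z - z) * ∑ a ∈ P.erase z, res a * (z - a)⁻¹)) := by
        refine ((hres z hzP).sub_const _).sub ?_
        have h3 : ContinuousAt (fun y => (y - z) * ∑ a ∈ P.erase z, res a * (y - a)⁻¹) z :=
          ((continuousAt_id.sub continuousAt_const).mul
            (hsum (P.erase z) z (by simp)).continuousAt)
        exact h3.tendsto.mono_left nhdsWithin_le_nhds
      simp only [sub_self, zero_mul] at h2
      refine h2.congr' ?_
      filter_upwards [self_mem_nhdsWithin] with y hy
      have hyz : y - z ≠ 0 := sub_ne_zero.mpr hy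
      rw [hF]
      simp only
      rw [← Finset.add_sum_erase P _ hzP]
      field_simp
      ring
    have ho' : (fun y => F y - F z) =o[𝓝[≠] z] fun y => (y - z)⁻¹ := by
      have h4 : Tendsto (fun y => (F y - F z) / (y - z)⁻¹) (𝓝[≠] z) (𝓝 0) := by
        have h5 : Tendsto (fun y => (y - z) * F y - (y - z) * F z) (𝓝[≠] z) (𝓝 (0 - 0)) := by
          refine ho.sub ?_
          have h6 : Continuous fun y => (y - z) * F z := by fun_prop
          simpa using (h6.tendsto z).mono_left (nhdsWithin_le_nhds (s := {z}ᶜ))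
        rw [sub_zero] at h5
        refine h5.congr fun y => ?_
        rw [div_inv_eq_mul]
        ring
      refine (isLittleO_iff_tendsto' ?_).mpr h4
      filter_upwards [self_mem_nhdsWithin] with y hy h0
      exact absurd (inv_eq_zero.mp h0) (sub_ne_zero.mpr hy)
    have hins := Complex.differentiableOn_update_limUnder_insert_of_isLittleO
      (s := {y | AnalyticAt ℂ F y}) hd
      (fun y hy => (AnalyticAt.differentiableAt hy).differentiableWithinAt) ho'
    have hmem : insert z {y | AnalyticAt ℂ F y} ∈ 𝓝 z := insert_mem_nhds_iff.mpr hd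
    have hupd : AnalyticAt ℂ (Function.update F z (limUnder (𝓝[≠] z) F)) z :=
      hins.analyticAt hmem
    refine hupd.congr ?_
    filter_upwards [hmem] with y hy
    by_cases hyz : y = z
    · subst hyz; simp [h]
    · rw [Function.update_of_ne hyz]
      exact (hhF y (hy.resolve_left hyz)).symm
  · have hFz := hFan z (han z hz hzP) hzP
    refine hFz.congr ?_
    filter_upwards [hFz.eventually_analyticAt] with y hy
    exact (hhF y hy).symm

/-- The residue theorem for a circle and finitely many simple poles, with the weights `1 / z` and
`1 / z ^ 2`. -/
theorem circleAverage_eq_add_sum_residues {G : ℂ → ℂ} {R : ℝ} (hR : 0 < R) {P : Finset ℂ}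
    (hP : ∀ a ∈ P, a ≠ 0 ∧ a ∈ Metric.ball (0 : ℂ) R) {res : ℂ → ℂ}
    (hres : ∀ a ∈ P, Tendsto (fun z => (z - a) * G z) (𝓝[≠] a) (𝓝 (res a)))
    (hpunct : ∀ a ∈ P, ∀ᶠ z in 𝓝[≠] a, AnalyticAt ℂ G z)
    (han : ∀ z ∈ Metric.closedBall (0 : ℂ) R, z ∉ P → AnalyticAt ℂ G z) :
    Real.circleAverage G 0 R = G 0 + ∑ a ∈ P, res a / a ∧
    Real.circleAverage (fun z => G z / z) 0 R = deriv G 0 + ∑ a ∈ P, res a / a ^ 2 := by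
  obtain ⟨h, hh, hhG⟩ := exists_analytic_eq_sub_principal_parts hres hpunct han
  have h0P : (0 : ℂ) ∉ P := fun h0 => (hP 0 h0).1 rfl
  have hG0 : AnalyticAt ℂ G 0 := han 0 (by simpa using hR.le) h0P
  have hsph : ∀ z ∈ Metric.sphere (0 : ℂ) R, z ∉ P := fun z hz hzP => by
    have := (hP z hzP).2
    simp only [mem_sphere_iff_norm, Metric.mem_ball, dist_zero_right, sub_zero] at hz this
    exact this.ne hz
  have hne : ∀ z ∈ Metric.sphere (0 : ℂ) R, z ≠ 0 := fun z hz h0 => by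
    rw [h0] at hz
    simp at hz
    exact hR.ne hz
  have hGs : ∀ z ∈ Metric.sphere (0 : ℂ) R, G z = h z + ∑ a ∈ P, res a • (z - a)⁻¹ :=
    fun z hz => by
      rw [hhG z (han z (Metric.sphere_subset_closedBall hz) (hsph z hz)) (hsph z hz)]
      simp
  have hhc : ContinuousOn h (Metric.sphere 0 R) := fun z hz =>
    (hh z (Metric.sphere_subset_closedBall hz)).continuousAt.continuousWithinAt
  have hic : ∀ a ∈ P, ContinuousOn (fun z => (z - a)⁻¹) (Metric.sphere 0 R) := fun a ha =>
    ContinuousOn.inv₀ (by fun_prop) fun z hz h0 => hsph z hz (by rwa [sub_eq_zero.mp h0])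
  constructor
  · have e1 : Set.EqOn G (fun z => h z + ∑ a ∈ P, res a • (z - a)⁻¹) (Metric.sphere 0 |R|) := by
      rw [abs_of_pos hR]; exact hGs
    have hi : ∀ a ∈ P, CircleIntegrable (fun z => res a • (z - a)⁻¹) 0 R := fun a ha =>
      ContinuousOn.circleIntegrable hR.le (by exact (hic a ha).const_smul (res a))
    have hd : DiffContOnCl ℂ h (Metric.ball 0 |R|) := by
      rw [abs_of_pos hR]
      refine DifferentiableOn.diffContOnCl fun z hz => ?_
      rw [closure_ball _ hR.ne'] at hz
      exact (hh z hz).differentiableAt.differentiableWithinAt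
    rw [Real.circleAverage_congr_sphere e1, Real.circleAverage_fun_add
      (hhc.circleIntegrable hR.le) (CircleIntegrable.fun_sum _ hi),
      Real.circleAverage_fun_sum hi, hd.circleAverage,
      Finset.sum_eq_zero fun a ha => by
        rw [Real.circleAverage_fun_smul, circleAverage_inv_sub_eq_zero (hP a ha).1 (hP a ha).2,
          smul_zero]]
    rw [add_zero, hhG 0 hG0 h0P, sub_eq_add_neg, ← Finset.sum_neg_distrib]
    congr 1
    refine Finset.sum_congr rfl fun a ha => ?_
    rw [zero_sub, inv_neg, div_eq_mul_inv]
    ring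
  · have e1 : Set.EqOn (fun z => G z / z) (fun z => h z / z + ∑ a ∈ P, res a • ((z - a)⁻¹ / z))
        (Metric.sphere 0 |R|) := by
      rw [abs_of_pos hR]
      intro z hz
      simp only
      rw [hGs z hz, add_div, Finset.sum_div]
      simp [mul_div_assoc]
    have hi : ∀ a ∈ P, CircleIntegrable (fun z => res a • ((z - a)⁻¹ / z)) 0 R := fun a ha =>
      ContinuousOn.circleIntegrable hR.le
        (by exact ((hic a ha).div continuousOn_id hne).const_smul (res a))
    have hi0 : CircleIntegrable (fun z => h z / z) 0 R :=
      ContinuousOn.circleIntegrable hR.le (hhc.div continuousOn_id hne)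
    rw [Real.circleAverage_congr_sphere e1, Real.circleAverage_fun_add hi0
      (CircleIntegrable.fun_sum _ hi),
      Real.circleAverage_fun_sum hi, circleAverage_div_eq_deriv hR hh,
      Finset.sum_eq_zero fun a ha => by
        rw [Real.circleAverage_fun_smul, circleAverage_inv_sub_div_eq_zero (hP a ha).1 (hP a ha).2,
          smul_zero], add_zero]
    have hev : h =ᶠ[𝓝 0] fun z => G z - ∑ a ∈ P, res a * (z - a)⁻¹ := by
      have h1 : ∀ᶠ z in 𝓝 (0 : ℂ), z ∉ P :=
        P.finite_toSet.isClosed.isOpen_compl.mem_nhds (by simpa using h0P)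
      filter_upwards [hG0.eventually_analyticAt, h1] with z hz1 hz2 using hhG z hz1 hz2
    rw [hev.deriv_eq]
    have hda : ∀ a ∈ P, HasDerivAt (fun z => res a * (z - a)⁻¹) (-(res a / a ^ 2)) 0 := by
      intro a ha
      have h2 := (((hasDerivAt_id (0 : ℂ)).sub_const a).inv
        (by simpa using (hP a ha).1)).const_mul (res a)
      simp only [id, zero_sub] at h2
      have h4 : res a * (-1 / (-a) ^ 2) = -(res a / a ^ 2) := by
        rw [neg_sq]
        ring
      rw [h4] at h2
      exact h2
    have h3 := hG0.differentiableAt.hasDerivAt.fun_sub (HasDerivAt.fun_sum hda)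
    rw [h3.deriv, Finset.sum_neg_distrib, sub_neg_eq_add]

/-! ### Poles of the correlator and zeros of `f` -/

theorem analyticAt_of_notMem_spectrumOf {G : ℂ → ℂ} (hG : MeromorphicNFOn G Set.univ) {z : ℂ}
    (hz : z ∉ spectrumOf G) : AnalyticAt ℂ G z :=
  (hG (Set.mem_univ z)).meromorphicOrderAt_nonneg_iff_analyticAt.mp (not_lt.mp hz)

theorem spectralDensity_neg (G : ℂ → ℂ) (z : ℂ) :
    spectralDensity G (-z) = -spectralDensity G z := by
  simp only [spectralDensity, neg_neg]
  ring

/-- The residue of `G` at a simple pole. -/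
theorem exists_residue_of_meromorphicOrderAt_eq_neg_one {G : ℂ → ℂ} {a : ℂ}
    (ha : meromorphicOrderAt G a = -1) :
    ∃ r : ℂ, r ≠ 0 ∧ Tendsto (fun z => (z - a) * G z) (𝓝[≠] a) (𝓝 r) := by
  have hm : MeromorphicAt G a :=
    meromorphicAt_of_meromorphicOrderAt_ne_zero (by rw [ha]; decide)
  obtain ⟨g, hg, hg0, hge⟩ := (meromorphicOrderAt_eq_int_iff (n := -1) hm).mp (by exact_mod_cast ha)
  refine ⟨g a, hg0, (hg.continuousAt.tendsto.mono_left nhdsWithin_le_nhds).congr' ?_⟩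
  filter_upwards [hge, self_mem_nhdsWithin] with z hz hza
  have : z - a ≠ 0 := sub_ne_zero.mpr hza
  rw [hz, zpow_neg_one, smul_eq_mul]
  field_simp

namespace IsThermalCorrelator

variable {β Δ : ℝ} {d : ℕ} {G : ℂ → ℂ}

theorem im_neg (hG : IsThermalCorrelator β Δ d G) {a : ℂ} (ha : a ∈ spectrumOf G) : a.im < 0 := by
  by_contra h
  exact not_le.mpr ha (hG.retarded a (not_lt.mp h)).meromorphicOrderAt_nonneg

theorem ne_zero (hG : IsThermalCorrelator β Δ d G) {a : ℂ} (ha : a ∈ spectrumOf G) : a ≠ 0 := by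
  rintro rfl
  simpa using hG.im_neg ha

theorem notMem_of_im_nonneg (hG : IsThermalCorrelator β Δ d G) {z : ℂ} (hz : 0 ≤ z.im) :
    z ∉ spectrumOf G := fun h => not_lt.mpr hz (hG.im_neg h)

theorem analyticAt_neg (hG : IsThermalCorrelator β Δ d G) {a : ℂ} (ha : a ∈ spectrumOf G) :
    AnalyticAt ℂ G (-a) :=
  hG.retarded _ (by simpa using (hG.im_neg ha).le)

theorem eventually_analyticAt (hG : IsThermalCorrelator β Δ d G) (a : ℂ) :
    ∀ᶠ z in 𝓝[≠] a, AnalyticAt ℂ G z :=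
  (hG.meromorphic (Set.mem_univ a)).meromorphicAt.eventually_analyticAt

/-- Near a pole `a` of `G`, the spectral density has residue `r / (2 i)`. -/
theorem tendsto_spectralDensity (hG : IsThermalCorrelator β Δ d G) {a r : ℂ}
    (ha : a ∈ spectrumOf G) (hr : Tendsto (fun z => (z - a) * G z) (𝓝[≠] a) (𝓝 r)) :
    Tendsto (fun z => (z - a) * spectralDensity G z) (𝓝[≠] a) (𝓝 (r / (2 * Complex.I))) := by
  have h1 : ContinuousAt (fun z => (z - a) * G (-z)) a := by
    refine ContinuousAt.mul (by fun_prop) ?_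
    exact (hG.analyticAt_neg ha).continuousAt.comp (f := fun w : ℂ => -w) continuousAt_neg
  have h2 := (hr.sub (h1.tendsto.mono_left nhdsWithin_le_nhds)).div_const (2 * Complex.I)
  simp only [sub_self, zero_mul, sub_zero] at h2
  refine h2.congr fun z => ?_
  rw [spectralDensity]
  ring

theorem sinh_ne_zero (hβ : 0 < β) {x : ℝ} (hx : x ≠ 0) :
    Complex.sinh (β * x / 2) ≠ 0 := by
  have : Complex.sinh ((β : ℂ) * x / 2) = ((Real.sinh (β * x / 2) : ℝ) : ℂ) := by push_cast; rfl
  rw [this, Complex.ofReal_ne_zero]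
  simp [hβ.ne', hx]

section ThermalProduct

variable {f : ℂ → ℂ} (hG : IsThermalCorrelator β Δ d G) (hβ : 0 < β) (hf : Differentiable ℂ f)
  (hfρ : ∀ ω : ℂ, ω ∉ spectrumOf G → -ω ∉ spectrumOf G →
    f ω * spectralDensity G ω = Complex.sinh (β * ω / 2))
  (hf0 : ∀ ω : ℂ, f ω = 0 → (ω ∈ spectrumOf G ∨ -ω ∈ spectrumOf G) ∧ deriv f ω ≠ 0)

include hG hfρ in
theorem mul_spectralDensity_ofReal (x : ℝ) :
    f x * spectralDensity G x = Complex.sinh (β * x / 2) :=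
  hfρ x (hG.notMem_of_im_nonneg (by simp)) (hG.notMem_of_im_nonneg (by simp))

include hG hβ hf hfρ in
-- On the real axis `ρ` and `sinh` are odd, and away from `0` neither vanishes, so `f (-x) = f x`
-- there. The identity theorem does the rest.
theorem even_of_mul_spectralDensity (z : ℂ) : f (-z) = f z := by
  have h1 : AnalyticOnNhd ℂ (fun z => f (-z)) Set.univ := fun z _ =>
    (hf.comp differentiable_neg).analyticAt z
  have h2 : AnalyticOnNhd ℂ f Set.univ := fun z _ => hf.analyticAt z
  have hreal : ∀ x : ℝ, x ≠ 0 → f (-(x : ℂ)) = f x := fun x hx => by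
    have e1 := mul_spectralDensity_ofReal hG hfρ x
    have e2 := mul_spectralDensity_ofReal hG hfρ (-x)
    have e3 := sinh_ne_zero hβ hx
    rw [Complex.ofReal_neg, spectralDensity_neg, mul_neg, mul_neg, neg_div,
      Complex.sinh_neg, neg_inj] at e2
    have e4 : spectralDensity G x ≠ 0 := fun h0 => by
      rw [h0, mul_zero] at e1
      exact e3 e1.symm
    exact mul_right_cancel₀ e4 (e2.trans e1.symm)
  have ht : Tendsto (fun x : ℝ => (x : ℂ)) (𝓝[≠] 0) (𝓝[≠] 0) := by
    refine tendsto_nhdsWithin_iff.mpr ⟨?_, ?_⟩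
    · exact (Complex.continuous_ofReal.tendsto' 0 0 (by simp)).mono_left nhdsWithin_le_nhds
    · filter_upwards [self_mem_nhdsWithin] with x hx
      simpa using hx
  have hfr : ∃ᶠ z in 𝓝[≠] (0 : ℂ), f (-z) = f z := by
    refine ht.frequently (Eventually.frequently ?_)
    filter_upwards [self_mem_nhdsWithin] with x hx using hreal x hx
  exact congrFun (h1.eq_of_frequently_eq h2 hfr) z

include hG hf hfρ in
theorem apply_zero_mul_deriv_zero : f 0 * deriv G 0 = Complex.I * β / 2 := by
  have hG0 : AnalyticAt ℂ G 0 := hG.retarded 0 le_rfl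
  have hev : (fun z => f z * spectralDensity G z) =ᶠ[𝓝 0] fun z => Complex.sinh (β * z / 2) := by
    have h1 := hG0.eventually_analyticAt
    have h2 : ∀ᶠ z in 𝓝 (0 : ℂ), AnalyticAt ℂ G (-z) :=
      (continuous_neg.tendsto' (0 : ℂ) 0 neg_zero).eventually h1
    filter_upwards [h1, h2] with z hz1 hz2
    exact hfρ z (not_lt.mpr hz1.meromorphicOrderAt_nonneg)
      (not_lt.mpr hz2.meromorphicOrderAt_nonneg)
  have hρ : HasDerivAt (spectralDensity G) (deriv G 0 / Complex.I) 0 := by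
    have h1 := hG0.differentiableAt.hasDerivAt
    have h2 : HasDerivAt (fun z => G (-z)) (-deriv G 0) 0 := by
      have h3 : HasDerivAt G (deriv G 0) (-(0 : ℂ)) := by rwa [neg_zero]
      simpa [Function.comp_def] using h3.scomp (0 : ℂ) (hasDerivAt_neg (0 : ℂ))
    have h4 := (h1.fun_sub h2).div_const (2 * Complex.I)
    have h5 : (deriv G 0 - -deriv G 0) / (2 * Complex.I) = deriv G 0 / Complex.I := by
      field_simp
      ring
    rw [h5] at h4
    exact h4
  have hs : HasDerivAt (fun z : ℂ => Complex.sinh (β * z / 2)) (β / 2) 0 := by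
    have h1 : HasDerivAt (fun z : ℂ => (β : ℂ) * z / 2) (β / 2) 0 := by
      simpa using ((hasDerivAt_id (0 : ℂ)).const_mul (β : ℂ)).div_const 2
    simpa using h1.csinh
  have h6 := (hf 0).hasDerivAt.fun_mul hρ
  have hρ0 : spectralDensity G 0 = 0 := by simp [spectralDensity]
  rw [hρ0, mul_zero, zero_add] at h6
  have h7 := h6.unique (hs.congr_of_eventuallyEq hev)
  have h8 := Complex.I_ne_zero
  field_simp at h7 ⊢
  linear_combination h7

include hG hf hfρ in
/-- The zeros of `f` at the poles of `G` and the derivative of `f` there. -/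
theorem apply_eq_zero_and_deriv_mul_residue {a r : ℂ} (ha : a ∈ spectrumOf G) (hr0 : r ≠ 0)
    (hr : Tendsto (fun z => (z - a) * G z) (𝓝[≠] a) (𝓝 r)) :
    f a = 0 ∧ deriv f a * r = 2 * Complex.I * Complex.sinh (β * a / 2) := by
  have hρ := hG.tendsto_spectralDensity ha hr
  have hev : ∀ᶠ z in 𝓝[≠] a, f z * spectralDensity G z = Complex.sinh (β * z / 2) := by
    have h2 : ∀ᶠ z in 𝓝[≠] a, AnalyticAt ℂ G (-z) :=
      nhdsWithin_le_nhds ((continuous_neg.tendsto a).eventually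
        (hG.analyticAt_neg ha).eventually_analyticAt)
    filter_upwards [hG.eventually_analyticAt a, h2] with z hz1 hz2
    exact hfρ z (not_lt.mpr hz1.meromorphicOrderAt_nonneg)
      (not_lt.mpr hz2.meromorphicOrderAt_nonneg)
  have hs : Continuous fun z : ℂ => Complex.sinh (β * z / 2) := by fun_prop
  have hfa : f a = 0 := by
    have h1 := ((hf.continuous.tendsto a).mono_left nhdsWithin_le_nhds).mul hρ
    have h2 : Tendsto (fun z => (z - a) * Complex.sinh (β * z / 2)) (𝓝[≠] a) (𝓝 0) := by
      have h3 : Continuous fun z : ℂ => (z - a) * Complex.sinh (β * z / 2) := by fun_prop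
      simpa using (h3.tendsto a).mono_left (nhdsWithin_le_nhds (s := {a}ᶜ))
    have h4 := tendsto_nhds_unique h1 (h2.congr' ?_)
    · have : r / (2 * Complex.I) ≠ 0 := by simp [hr0]
      exact (mul_eq_zero.mp h4).resolve_right this
    · filter_upwards [hev] with z hz
      rw [← hz]
      ring
  refine ⟨hfa, ?_⟩
  have h1 : Tendsto (slope f a) (𝓝[≠] a) (𝓝 (deriv f a)) :=
    hasDerivAt_iff_tendsto_slope.mp (hf a).hasDerivAt
  have h2 := tendsto_nhds_unique ((h1.mul hρ).congr' ?_)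
    ((hs.tendsto a).mono_left nhdsWithin_le_nhds)
  · have h8 := Complex.I_ne_zero
    field_simp at h2 ⊢
    linear_combination h2
  · filter_upwards [hev, self_mem_nhdsWithin] with z hz hza
    have : z - a ≠ 0 := sub_ne_zero.mpr hza
    rw [← hz, slope_def_field, hfa]
    field_simp
    ring

include hG hβ hf hfρ hf0 in
/-- The product over the other poles, expressed by the derivative of `f`. -/
theorem mirrorProduct_eq
    (hgrow : ∃ r : ℝ, ∀ ω : ℂ, r ≤ ‖ω‖ → ‖f ω‖ < Real.exp (‖ω‖ ^ (1 + 1 / 2 : ℝ)))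
    {a : ℂ} (ha : a ∈ spectrumOf G) :
    Multipliable (mirrorFactor G a) ∧ mirrorProduct G a ≠ 0 ∧
      deriv f a * a = -2 * f 0 * mirrorProduct G a := by
  have heven := even_of_mul_spectralDensity hG hβ hf hfρ
  have hzero : ∀ z ∈ spectrumOf G, f z = 0 := fun z hz => by
    obtain ⟨r, hr0, hr⟩ := exists_residue_of_meromorphicOrderAt_eq_neg_one (hG.simple_poles z hz)
    exact (apply_eq_zero_and_deriv_mul_residue hG hf hfρ hz hr0 hr).1
  have hf00 : f 0 ≠ 0 := fun h => by
    have h0 : (0 : ℂ) ∉ spectrumOf G := hG.notMem_of_im_nonneg le_rfl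
    have := (hf0 0 h).1
    rw [neg_zero, or_self] at this
    exact h0 this
  -- Squaring is injective on the poles because all of them lie in the open lower half-plane.
  have hsq : ∀ z ∈ spectrumOf G, ∀ w ∈ spectrumOf G, z ^ 2 = w ^ 2 → z = w := by
    intro z hz w hw h
    rcases sq_eq_sq_iff_eq_or_eq_neg.mp h with h | h
    · exact h
    · have h1 := hG.im_neg hz
      have h2 := hG.im_neg hw
      rw [h, Complex.neg_im] at h1
      linarith
  obtain ⟨g, hg, hfg⟩ := exists_entire_comp_sq_of_even hf heven
  have hfd : ∀ z, deriv f z = deriv g (z ^ 2) * (2 * z) := fun z => by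
    have h1 : HasDerivAt (fun z => g (z ^ 2)) (deriv g (z ^ 2) * (2 * z)) z := by
      have := (hg (z ^ 2)).hasDerivAt.comp z (hasDerivAt_pow 2 z)
      simpa [Function.comp_def] using this
    rw [show f = fun z => g (z ^ 2) from funext hfg]
    exact h1.deriv
  have hgz : ∀ w, g w = 0 → (∃ z ∈ spectrumOf G, z ^ 2 = w) ∧ deriv g w ≠ 0 := by
    intro w hw
    obtain ⟨z, rfl⟩ := IsAlgClosed.exists_pow_nat_eq w two_pos
    rw [← hfg] at hw
    obtain ⟨h1, h2⟩ := hf0 z hw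
    refine ⟨?_, fun h => h2 (by rw [hfd, h, zero_mul])⟩
    rcases h1 with h1 | h1
    · exact ⟨z, h1, rfl⟩
    · exact ⟨-z, h1, by ring⟩
  have ha0 := hG.ne_zero ha
  have ha2 : a ^ 2 ≠ 0 := pow_ne_zero 2 ha0
  have hga : g (a ^ 2) = 0 := by rw [← hfg]; exact hzero a ha
  -- divide out the zero at `a ^ 2`
  obtain ⟨h, hh, hgh⟩ := exists_entire_eq_mul_prod (ι := Unit) hg (b := fun _ => a ^ 2)
    (fun _ _ _ => rfl) (fun _ => ha2) (fun _ => hga) {()}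
  simp only [Finset.prod_singleton] at hgh
  have hgd : ∀ w, deriv g w = deriv h w * (1 - w / a ^ 2) + h w * (-(1 / a ^ 2)) := fun w => by
    rw [show g = fun w => h w * (1 - w / a ^ 2) from funext hgh]
    have h1 : HasDerivAt (fun w : ℂ => 1 - w / a ^ 2) (-(1 / a ^ 2)) w :=
      ((hasDerivAt_id w).div_const (a ^ 2)).const_sub 1
    exact ((hh w).hasDerivAt.fun_mul h1).deriv
  have hha : h (a ^ 2) ≠ 0 := fun h0 => (hgz _ hga).2 (by rw [hgd, h0, div_self ha2]; ring)
  have hh0 : h 0 = f 0 := by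
    have h1 := hgh 0
    have h2 := hfg 0
    simp at h1 h2
    rw [h2, h1]
  let b : {w : ℂ // w ∈ spectrumOf G ∧ w ≠ a} → ℂ := fun w => (w : ℂ) ^ 2
  have hhz : ∀ w, h w = 0 → g w = 0 := fun w hw => by rw [hgh, hw, zero_mul]
  obtain ⟨r, hr⟩ := hgrow
  -- The growth exponent `3 / 2` in `z` becomes `σ = 3 / 4` in `z ^ 2`. Beyond `2 ‖a ^ 2‖` the
  -- removed factor has modulus at least `1`, so the quotient inherits the bound.
  have key := multipliable_and_eq_mul_tprod_of_order_lt_one hh (by rw [hh0]; exact hf00) (σ := 3 / 4) (r := max (r ^ 2) (2 * ‖a ^ 2‖)) (by norm_num)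
    (by norm_num) (fun w hw => by
      have hw1 : r ^ 2 ≤ ‖w‖ := (le_max_left _ _).trans hw
      have hw2 : 2 * ‖a ^ 2‖ ≤ ‖w‖ := (le_max_right _ _).trans hw
      obtain ⟨z, rfl⟩ := IsAlgClosed.exists_pow_nat_eq w two_pos
      have h1 : ‖g (z ^ 2)‖ ≤ Real.exp (‖z ^ 2‖ ^ (3 / 4 : ℝ)) := by
        rw [← hfg]
        have h2 : r ≤ ‖z‖ := by
          rw [norm_pow] at hw1
          exact le_of_abs_le (sq_le_sq.mp hw1 |>.trans_eq (abs_of_nonneg (norm_nonneg z)))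
        refine (hr z h2).le.trans_eq ?_
        rw [norm_pow, ← Real.rpow_natCast, ← Real.rpow_mul (norm_nonneg _)]
        norm_num
      have h3 : 1 ≤ ‖1 - z ^ 2 / a ^ 2‖ := by
        have h4 : 2 ≤ ‖z ^ 2 / a ^ 2‖ := by
          rw [norm_div, le_div_iff₀ (norm_pos_iff.mpr ha2)]
          exact hw2
        have h5 := norm_sub_norm_le (z ^ 2 / a ^ 2) 1
        rw [norm_one, norm_sub_rev] at h5
        linarith
      rw [hgh, norm_mul] at h1
      exact (le_mul_of_one_le_right (norm_nonneg _) h3).trans h1)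
    (b := b) (fun u v huv => Subtype.ext (hsq _ u.2.1 _ v.2.1 huv))
    (fun w => ⟨fun hw => by
      obtain ⟨⟨z, hz, rfl⟩, -⟩ := hgz w (hhz w hw)
      exact ⟨⟨z, hz, by rintro rfl; exact hha hw⟩, rfl⟩, by
      rintro ⟨u, rfl⟩
      have h1 : g (b u) = 0 := by
        simp only [b]
        rw [← hfg]
        exact hzero _ u.2.1
      rw [hgh] at h1
      refine (mul_eq_zero.mp h1).resolve_right fun h2 => u.2.2 ?_
      rw [sub_eq_zero, eq_comm, div_eq_one_iff_eq ha2] at h2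
      exact hsq _ u.2.1 _ ha h2⟩)
    (fun w hw h1 => (hgz w (hhz w hw)).2 (by
      rw [hgd, h1, hw]
      ring))
    (a ^ 2)
  have hfac : (fun i => 1 - a ^ 2 / b i) = mirrorFactor G a := by
    funext w
    simp only [b, mirrorFactor, div_pow]
  rw [hfac, ← mirrorProduct, hh0] at key
  refine ⟨key.1, fun h0 => hha (by rw [key.2, h0, mul_zero]), ?_⟩
  rw [hfd, hgd, div_self ha2, key.2]
  field_simp
  ring

end ThermalProduct

end IsThermalCorrelator

/-! ### Integrals over upper half circles -/

theorem circleMap_zero_add_pi (R θ : ℝ) : circleMap 0 R (θ + Real.pi) = -circleMap 0 R θ := by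
  simp [circleMap, add_mul, Complex.exp_add]

theorem circleMap_zero_pi_sub (R θ : ℝ) :
    circleMap 0 R (Real.pi - θ) = -(starRingEnd ℂ) (circleMap 0 R θ) := by
  simp [circleMap, sub_mul, Complex.exp_sub, ← Complex.exp_conj, Complex.exp_neg, div_eq_mul_inv]

theorem circleMap_zero_im_nonneg {R θ : ℝ} (hR : 0 ≤ R) (hθ : θ ∈ Set.Icc 0 Real.pi) :
    0 ≤ (circleMap 0 R θ).im := by
  have : (circleMap 0 R θ).im = R * Real.sin θ := by
    simp [circleMap, Complex.exp_ofReal_mul_I_im]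
  rw [this]
  exact mul_nonneg hR (Real.sin_nonneg_of_nonneg_of_le_pi hθ.1 hθ.2)

theorem norm_circleAverage_le {f : ℂ → ℂ} {R B : ℝ} (hR : 0 < R)
    (hf : ∀ z, ‖z‖ = R → ‖f z‖ ≤ B) : ‖Real.circleAverage f 0 R‖ ≤ B := by
  have h1 : ‖∫ θ in (0 : ℝ)..2 * Real.pi, f (circleMap 0 R θ)‖ ≤ B * |2 * Real.pi - 0| :=
    intervalIntegral.norm_integral_le_of_norm_le_const fun θ _ => hf _ (by simp [abs_of_pos hR])
  rw [sub_zero, abs_of_pos Real.two_pi_pos] at h1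
  rw [Real.circleAverage, norm_smul, Real.norm_of_nonneg (by positivity),
    inv_mul_le_iff₀ Real.two_pi_pos]
  linarith

/-- The integral `∫ G (r e ^ (iθ)) dθ` over the upper half of a circle. -/
noncomputable def upperArcIntegral (G : ℂ → ℂ) (r : ℝ) : ℂ :=
  ∫ θ in (0 : ℝ)..Real.pi, G (circleMap 0 r θ)

section UpperHalfPlane

variable {G : ℂ → ℂ} (hG : ∀ z : ℂ, 0 ≤ z.im → AnalyticAt ℂ G z)

include hG in
-- Differentiation under the integral sign. The closed arc is compact and analyticity is an open
-- condition, so a thickening of the arc, reaching below the real axis, provides the uniform bound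
-- on `deriv G`.
theorem hasDerivAt_upperArcIntegral {r₀ : ℝ} (hr₀ : 0 ≤ r₀) :
    HasDerivAt (upperArcIntegral G)
      (∫ θ in (0 : ℝ)..Real.pi, Complex.exp (θ * Complex.I) * deriv G (circleMap 0 r₀ θ)) r₀ := by
  have huIoc : Set.uIoc 0 Real.pi ⊆ Set.Icc 0 Real.pi := by
    rw [Set.uIoc_of_le Real.pi_pos.le]
    exact Set.Ioc_subset_Icc_self
  have hKc : IsCompact (circleMap 0 r₀ '' Set.Icc 0 Real.pi) :=
    isCompact_Icc.image (continuous_circleMap 0 r₀)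
  obtain ⟨ε, hε, hεU⟩ := hKc.exists_cthickening_subset_open (isOpen_analyticAt ℂ G) (by
    rintro _ ⟨θ, hθ, rfl⟩
    exact hG _ (circleMap_zero_im_nonneg hr₀ hθ))
  have hmem : ∀ r ∈ Metric.ball r₀ ε, ∀ θ ∈ Set.Icc 0 Real.pi,
      circleMap 0 r θ ∈ Metric.cthickening ε (circleMap 0 r₀ '' Set.Icc 0 Real.pi) := by
    intro r hr θ hθ
    refine Metric.mem_cthickening_of_dist_le _ _ _ _ (Set.mem_image_of_mem _ hθ) ?_
    rw [dist_eq_norm]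
    have : circleMap 0 r θ - circleMap 0 r₀ θ =
        ((r - r₀ : ℝ) : ℂ) * Complex.exp (θ * Complex.I) := by
      simp [circleMap, sub_mul]
    rw [this, norm_mul, Complex.norm_exp_ofReal_mul_I, mul_one, Complex.norm_real]
    exact (mem_ball_iff_norm.mp hr).le
  have hcd : ContinuousOn (deriv G)
      (Metric.cthickening ε (circleMap 0 r₀ '' Set.Icc 0 Real.pi)) := fun z hz =>
    (AnalyticAt.deriv (hεU hz)).continuousAt.continuousWithinAt
  obtain ⟨M, hM⟩ := (hKc.cthickening (r := ε)).exists_bound_of_continuousOn hcd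
  have hc1 : ∀ r ∈ Metric.ball r₀ ε,
      ContinuousOn (fun θ => G (circleMap 0 r θ)) (Set.Icc 0 Real.pi) := fun r hr θ hθ =>
    ((AnalyticAt.continuousAt (hεU (hmem r hr θ hθ))).comp
      (continuous_circleMap 0 r).continuousAt).continuousWithinAt
  have hc2 : ContinuousOn (fun θ : ℝ => Complex.exp (θ * Complex.I) * deriv G (circleMap 0 r₀ θ))
      (Set.Icc 0 Real.pi) := by
    refine ContinuousOn.mul (by fun_prop) ?_
    exact hcd.comp (continuous_circleMap 0 r₀).continuousOn
      fun θ hθ => hmem r₀ (Metric.mem_ball_self hε) θ hθ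
  refine (intervalIntegral.hasDerivAt_integral_of_dominated_loc_of_deriv_le
    (F := fun r θ => G (circleMap 0 r θ))
    (F' := fun r θ => Complex.exp (θ * Complex.I) * deriv G (circleMap 0 r θ))
    (bound := fun _ => M) (Metric.ball_mem_nhds r₀ hε) ?_ ?_ ?_ ?_ (by simp) ?_).2
  · filter_upwards [Metric.ball_mem_nhds r₀ hε] with r hr
    exact ((hc1 r hr).mono huIoc).aestronglyMeasurable measurableSet_uIoc
  · refine ContinuousOn.intervalIntegrable ?_
    rw [Set.uIcc_of_le Real.pi_pos.le]
    exact hc1 r₀ (Metric.mem_ball_self hε)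
  · exact (hc2.mono huIoc).aestronglyMeasurable measurableSet_uIoc
  · refine Eventually.of_forall fun θ hθ r hr => ?_
    rw [norm_mul, Complex.norm_exp_ofReal_mul_I, one_mul]
    exact hM _ (hmem r hr θ (huIoc hθ))
  · refine Eventually.of_forall fun θ hθ r hr => ?_
    have h1 := (AnalyticAt.differentiableAt (hεU (hmem r hr θ (huIoc hθ)))).hasDerivAt
    have h2 : HasDerivAt (fun r : ℝ => circleMap 0 r θ) (Complex.exp (θ * Complex.I)) r := by
      have h3 := ((hasDerivAt_id r).ofReal_comp).mul_const (Complex.exp (θ * Complex.I))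
      simpa [circleMap] using h3
    rw [mul_comm]
    exact h1.comp r h2

include hG in
-- Up to the factor `i`, the integrand times `r` is the `θ`-derivative of `G (r e ^ (iθ))`, so only
-- the endpoints `-r` and `r` contribute.
theorem mul_deriv_upperArcIntegral {r : ℝ} (hr : 0 ≤ r) :
    r * ∫ θ in (0 : ℝ)..Real.pi, Complex.exp (θ * Complex.I) * deriv G (circleMap 0 r θ) =
      -2 * spectralDensity G r := by
  have huIcc : Set.uIcc 0 Real.pi = Set.Icc 0 Real.pi := Set.uIcc_of_le Real.pi_pos.le
  have han : ∀ θ ∈ Set.uIcc 0 Real.pi, AnalyticAt ℂ G (circleMap 0 r θ) := fun θ hθ =>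
    hG _ (circleMap_zero_im_nonneg hr (huIcc ▸ hθ))
  have h1 : ∀ θ ∈ Set.uIcc 0 Real.pi, HasDerivAt (fun θ => G (circleMap 0 r θ))
      (deriv G (circleMap 0 r θ) * (circleMap 0 r θ * Complex.I)) θ := fun θ hθ =>
    (han θ hθ).differentiableAt.hasDerivAt.comp θ (hasDerivAt_circleMap 0 r θ)
  have hcd : ContinuousOn (fun θ => deriv G (circleMap 0 r θ)) (Set.uIcc 0 Real.pi) := fun θ hθ =>
    ((han θ hθ).deriv.continuousAt.comp
      (continuous_circleMap 0 r).continuousAt).continuousWithinAt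
  have h2 := intervalIntegral.integral_eq_sub_of_hasDerivAt h1 (ContinuousOn.intervalIntegrable
    (hcd.mul (by fun_prop)))
  have h3 : ∀ θ : ℝ, deriv G (circleMap 0 r θ) * (circleMap 0 r θ * Complex.I) =
      (Complex.I * r) * (Complex.exp (θ * Complex.I) * deriv G (circleMap 0 r θ)) := fun θ => by
    simp [circleMap]
    ring
  simp_rw [h3] at h2
  rw [intervalIntegral.integral_const_mul] at h2
  have h4 : circleMap 0 r Real.pi = -r := by simp [circleMap]
  have h5 : circleMap 0 r 0 = r := by simp [circleMap]
  rw [h4, h5] at h2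
  rw [spectralDensity]
  have hI := Complex.I_ne_zero
  field_simp
  linear_combination h2

end UpperHalfPlane

/-- Grönwall's inequality along an arc on which the logarithmic derivative is bounded. -/
theorem norm_le_exp_mul_of_logDeriv_le {G : ℂ → ℂ} {R C : ℝ} {θ₀ θ₁ : ℝ} (hR : 0 < R)
    (han : ∀ θ ∈ Set.Icc θ₀ θ₁, AnalyticAt ℂ G (circleMap 0 R θ))
    (hlog : ∀ θ ∈ Set.Icc θ₀ θ₁, ‖logDeriv G (circleMap 0 R θ)‖ ≤ C / R)
    {θ : ℝ} (hθ : θ ∈ Set.Icc θ₀ θ₁) :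
    ‖G (circleMap 0 R θ)‖ ≤ ‖G (circleMap 0 R θ₀)‖ * Real.exp (C * (θ - θ₀)) := by
  have hder : ∀ t ∈ Set.Icc θ₀ θ₁, HasDerivAt (fun θ => G (circleMap 0 R θ))
      (deriv G (circleMap 0 R t) * (circleMap 0 R t * Complex.I)) t := fun t ht =>
    (han t ht).differentiableAt.hasDerivAt.comp t (hasDerivAt_circleMap 0 R t)
  have hne : ∀ t ∈ Set.Icc θ₀ θ₁, G (circleMap 0 R t) ≠ 0 →
      ‖deriv G (circleMap 0 R t)‖ ≤ C / R * ‖G (circleMap 0 R t)‖ := fun t ht h0 => by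
    have := hlog t ht
    rwa [logDeriv_apply, norm_div, div_le_iff₀ (norm_pos_iff.mpr h0)] at this
  -- At a zero of `G` the quotient `logDeriv G` is `0` by convention and says nothing about `deriv
  -- G`. Either `G` vanishes identically nearby, or the inequality passes to the limit from later
  -- points of the arc.
  have hall : ∀ t ∈ Set.Ico θ₀ θ₁,
      ‖deriv G (circleMap 0 R t)‖ ≤ C / R * ‖G (circleMap 0 R t)‖ := by
    intro t ht
    have ht' := Set.Ico_subset_Icc_self ht
    rcases (han t ht').eventually_eq_zero_or_eventually_ne_zero with h | h
    · have h1 : G =ᶠ[𝓝 (circleMap 0 R t)] fun _ => 0 := h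
      rw [h1.deriv_eq, h1.eq_of_nhds]
      simp
    · have h1 : Tendsto (circleMap 0 R) (𝓝[>] t) (𝓝[≠] circleMap 0 R t) :=
        ((hasDerivAt_circleMap 0 R t).tendsto_nhdsNE (by simp [hR.ne'])).mono_left
          (nhdsWithin_mono _ fun x hx => ne_of_gt hx)
      have h2 : Tendsto (circleMap 0 R) (𝓝[>] t) (𝓝 (circleMap 0 R t)) :=
        h1.mono_right nhdsWithin_le_nhds
      refine le_of_tendsto_of_tendsto
        (((han t ht').deriv.continuousAt.tendsto.comp h2).norm)
        ((((han t ht').continuousAt.tendsto.comp h2).norm).const_mul (C / R)) ?_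
      filter_upwards [h1.eventually h, Ioo_mem_nhdsGT ht.2] with s hs hs'
      exact hne s ⟨ht.1.trans hs'.1.le, hs'.2.le⟩ hs
  have := norm_le_gronwallBound_of_norm_deriv_right_le (f := fun θ => G (circleMap 0 R θ))
    (f' := fun t => deriv G (circleMap 0 R t) * (circleMap 0 R t * Complex.I))
    (δ := ‖G (circleMap 0 R θ₀)‖) (K := C) (ε := 0)
    (fun t ht => (hder t ht).continuousAt.continuousWithinAt)
    (fun t ht => (hder t (Set.Ico_subset_Icc_self ht)).hasDerivWithinAt) le_rfl
    (fun t ht => by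
      have h1 := hall t ht
      rw [norm_mul, norm_mul, Complex.norm_I, mul_one, norm_circleMap_zero, abs_of_pos hR, add_zero]
      calc _ ≤ C / R * ‖G (circleMap 0 R t)‖ * R := by gcongr
        _ = _ := by field_simp) θ hθ
  rwa [gronwallBound_ε0] at this

/-! ### Decay of circle averages -/

namespace IsThermalCorrelator

variable {β Δ : ℝ} {d : ℕ} {G : ℂ → ℂ}

/-- A circle on which the spectral density is bounded carries no pole. -/
theorem norm_ne_of_bounded (hG : IsThermalCorrelator β Δ d G) {R B : ℝ} (hR : 0 < R)
    (hB : ∀ ω, ‖ω‖ = R → ‖spectralDensity G ω‖ ≤ B) {a : ℂ} (ha : a ∈ spectrumOf G) :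
    ‖a‖ ≠ R := by
  intro haR
  obtain ⟨r, hr0, hr⟩ := exists_residue_of_meromorphicOrderAt_eq_neg_one (hG.simple_poles a ha)
  have h1 := hG.tendsto_spectralDensity ha hr
  have hcm : circleMap 0 R a.arg = a := by
    rw [← haR, circleMap, zero_add, Complex.norm_mul_exp_arg_mul_I]
  have h2 : Tendsto (circleMap 0 R) (𝓝[≠] a.arg) (𝓝[≠] a) := by
    have := (hasDerivAt_circleMap 0 R a.arg).tendsto_nhdsNE
      (by simp [hR.ne'])
    rwa [hcm] at this
  -- Along the circle the bound forces `(z - a) ρ(z) → 0`, whereas the limit is the non-zero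
  -- residue.
  have h3 : Tendsto (fun θ => (circleMap 0 R θ - a) * spectralDensity G (circleMap 0 R θ))
      (𝓝[≠] a.arg) (𝓝 0) := by
    have h4 : Tendsto (fun θ => B * ‖circleMap 0 R θ - a‖) (𝓝[≠] a.arg) (𝓝 0) := by
      have h5 : Continuous fun θ => B * ‖circleMap 0 R θ - a‖ := by fun_prop
      exact (h5.tendsto' _ 0 (by rw [hcm]; simp)).mono_left nhdsWithin_le_nhds
    refine squeeze_zero_norm (fun θ => ?_) h4
    rw [norm_mul, mul_comm]
    gcongr
    exact hB _ (by simp [abs_of_pos hR])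
  have h6 := tendsto_nhds_unique (h1.comp h2) h3
  simp [hr0] at h6

theorem analyticAt_of_norm_eq (hG : IsThermalCorrelator β Δ d G) {R B : ℝ} (hR : 0 < R)
    (hB : ∀ ω, ‖ω‖ = R → ‖spectralDensity G ω‖ ≤ B) {z : ℂ} (hz : ‖z‖ = R) : AnalyticAt ℂ G z :=
  analyticAt_of_notMem_spectrumOf hG.meromorphic fun h => hG.norm_ne_of_bounded hR hB h hz

/-- `G z / z` and `G (-z) / (-z)` have the same average, and their sum is `2 i ρ(z) / z`. -/
theorem norm_circleAverage_div_le (hG : IsThermalCorrelator β Δ d G) {R B : ℝ} (hR : 0 < R)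
    (hB : ∀ ω, ‖ω‖ = R → ‖spectralDensity G ω‖ ≤ B) :
    ‖Real.circleAverage (fun z => G z / z) 0 R‖ ≤ B / R := by
  have hc : ∀ z ∈ Metric.sphere (0 : ℂ) R, ContinuousAt G z := fun z hz =>
    (hG.analyticAt_of_norm_eq hR hB (by simpa using hz)).continuousAt
  have hne : ∀ z ∈ Metric.sphere (0 : ℂ) R, z ≠ 0 := fun z hz h0 => by
    rw [h0] at hz
    simp at hz
    exact hR.ne hz
  have hi1 : CircleIntegrable (fun z => G z / z) 0 R :=
    ContinuousOn.circleIntegrable hR.le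
      (ContinuousOn.div (fun z hz => (hc z hz).continuousWithinAt) continuousOn_id hne)
  have hi2 : CircleIntegrable (fun z => G (-z) / -z) 0 R := by
    refine ContinuousOn.circleIntegrable hR.le
      (ContinuousOn.div (fun z hz => ContinuousAt.continuousWithinAt ?_) continuousOn_id.neg
        fun z hz => neg_ne_zero.mpr (hne z hz))
    exact (hc (-z) (by simpa using hz)).comp (f := fun w : ℂ => -w) continuousAt_neg
  have h1 : Real.circleAverage (fun z => G (-z) / -z) 0 R =
      Real.circleAverage (fun z => G z / z) 0 R := by
    rw [← Real.circleAverage_neg_radius (f := fun z => G z / z)]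
    simp only [Real.circleAverage]
    congr 2
    funext θ
    simp [circleMap]
  have h2 : Real.circleAverage (fun z => spectralDensity G z / z) 0 R =
      Complex.I⁻¹ * Real.circleAverage (fun z => G z / z) 0 R := by
    have h3 : (fun z => spectralDensity G z / z) =
        fun z => (2 * Complex.I)⁻¹ • (G z / z + G (-z) / -z) := by
      funext z
      rw [spectralDensity, smul_eq_mul, div_neg]
      ring
    rw [h3, Real.circleAverage_fun_smul, Real.circleAverage_fun_add hi1 hi2, h1, smul_eq_mul]
    field_simp
    ring
  have h4 := norm_circleAverage_le (f := fun z => spectralDensity G z / z) (B := B / R) hR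
    fun z hz => by
      rw [norm_div, hz]
      gcongr
      exact hB z hz
  rw [h2, norm_mul, norm_inv, Complex.norm_I, inv_one, one_mul] at h4
  exact h4

/-- The full circle average of `G` in terms of the upper half circle and the spectral density. -/
theorem norm_pi_mul_circleAverage_sub_le (hG : IsThermalCorrelator β Δ d G) {R B : ℝ} (hR : 0 < R)
    (hB : ∀ ω, ‖ω‖ = R → ‖spectralDensity G ω‖ ≤ B) :
    ‖Real.pi * Real.circleAverage G 0 R - upperArcIntegral G R‖ ≤ B * Real.pi := by
  have hc : Continuous fun θ => G (circleMap 0 R θ) := continuous_iff_continuousAt.mpr fun θ =>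
    (hG.analyticAt_of_norm_eq hR hB (by simp [abs_of_pos hR])).continuousAt.comp
      (continuous_circleMap 0 R).continuousAt
  have h1 : (∫ θ in (0 : ℝ)..2 * Real.pi, G (circleMap 0 R θ)) =
      upperArcIntegral G R + ∫ θ in (0 : ℝ)..Real.pi, G (-circleMap 0 R θ) := by
    rw [← intervalIntegral.integral_add_adjacent_intervals (b := Real.pi)
      (hc.intervalIntegrable _ _) (hc.intervalIntegrable _ _), upperArcIntegral]
    congr 1
    have := intervalIntegral.integral_comp_add_right (a := 0) (b := Real.pi)
      (fun θ => G (circleMap 0 R θ)) Real.pi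
    rw [zero_add, ← two_mul] at this
    rw [← this]
    simp_rw [circleMap_zero_add_pi]
  have hcn : Continuous fun θ => G (-circleMap 0 R θ) := by
    simp_rw [← circleMap_zero_add_pi]
    exact hc.comp (continuous_id.add_const _)
  have h2 : (∫ θ in (0 : ℝ)..Real.pi, spectralDensity G (circleMap 0 R θ)) =
      (upperArcIntegral G R - ∫ θ in (0 : ℝ)..Real.pi, G (-circleMap 0 R θ)) / (2 * Complex.I) := by
    simp only [spectralDensity, upperArcIntegral]
    rw [intervalIntegral.integral_div,
      intervalIntegral.integral_sub (hc.intervalIntegrable _ _) (hcn.intervalIntegrable _ _)]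
  have h3 : ‖∫ θ in (0 : ℝ)..Real.pi, spectralDensity G (circleMap 0 R θ)‖ ≤
      B * |Real.pi - 0| :=
    intervalIntegral.norm_integral_le_of_norm_le_const fun θ _ => hB _ (by simp [abs_of_pos hR])
  rw [sub_zero, abs_of_pos Real.pi_pos] at h3
  have hπ : (Real.pi : ℂ) ≠ 0 := by exact_mod_cast Real.pi_ne_zero
  -- On the lower half `G (-z) = G z - 2 i ρ(z)`, so the full integral is twice the upper one minus
  -- `2 i ∫ ρ`.
  have h4 : Real.pi * Real.circleAverage G 0 R - upperArcIntegral G R =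
      -Complex.I * ∫ θ in (0 : ℝ)..Real.pi, spectralDensity G (circleMap 0 R θ) := by
    rw [Real.circleAverage, h1, h2, Complex.real_smul]
    have hI := Complex.I_ne_zero
    push_cast
    field_simp
    ring
  rw [h4, norm_mul, norm_neg, Complex.norm_I, one_mul]
  exact h3

/-- Hermiticity pairs the points at angles `θ` and `π - θ`. -/
theorem conj_upperArcIntegral (hG : IsThermalCorrelator β Δ d G) (r : ℝ) :
    (starRingEnd ℂ) (upperArcIntegral G r) = upperArcIntegral G r := by
  rw [upperArcIntegral, ← intervalIntegral.intervalIntegral_conj]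
  have := intervalIntegral.integral_comp_sub_left (a := 0) (b := Real.pi)
    (fun θ => G (circleMap 0 r θ)) Real.pi
  rw [sub_self, sub_zero] at this
  rw [← this]
  simp_rw [circleMap_zero_pi_sub, hG.hermitian]

theorem hasDerivAt_re_upperArcIntegral (hG : IsThermalCorrelator β Δ d G) {r : ℝ} (hr : 0 < r) :
    HasDerivAt (fun r => (upperArcIntegral G r).re) (-2 * (spectralDensity G r).re / r) r := by
  have h1 := hasDerivAt_upperArcIntegral hG.retarded hr.le
  have h2 := mul_deriv_upperArcIntegral hG.retarded hr.le
  have h3 := (Complex.reCLM.hasFDerivAt).comp_hasDerivAt r h1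
  simp only [Complex.reCLM_apply, Function.comp_def] at h3
  have h4 := congrArg Complex.re h2
  rw [Complex.re_ofReal_mul] at h4
  simp only [neg_mul, Complex.neg_re, Complex.mul_re, Complex.re_ofNat, Complex.im_ofNat, zero_mul,
    sub_zero] at h4
  have h5 : -2 * (spectralDensity G r).re / r = (∫ θ in (0 : ℝ)..Real.pi,
      Complex.exp (θ * Complex.I) * deriv G (circleMap 0 r θ)).re := by
    rw [div_eq_iff hr.ne']
    linarith
  rw [h5]
  exact h3

theorem antitoneOn_re_upperArcIntegral (hG : IsThermalCorrelator β Δ d G) :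
    AntitoneOn (fun r => (upperArcIntegral G r).re) (Set.Ici 0) := by
  have hc : ContinuousOn (fun r => (upperArcIntegral G r).re) (Set.Ici 0) := fun r hr =>
    (Complex.continuous_re.continuousAt.comp
      (hasDerivAt_upperArcIntegral hG.retarded hr).continuousAt).continuousWithinAt
  refine antitoneOn_of_deriv_nonpos (convex_Ici 0) hc ?_ ?_
  · rw [interior_Ici]
    exact fun r hr => (hG.hasDerivAt_re_upperArcIntegral hr).differentiableAt.differentiableWithinAt
  · rw [interior_Ici]
    intro r hr
    rw [(hG.hasDerivAt_re_upperArcIntegral hr).deriv, neg_mul, neg_div, neg_nonpos]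
    have hr' : 0 < r := hr
    have := nonneg_of_mul_nonneg_right (hG.positive r) hr'
    positivity

theorem tendsto_upperArcIntegral (hG : IsThermalCorrelator β Δ d G) (hct : NoContactTerm G) :
    Tendsto (upperArcIntegral G) atTop (𝓝 0) := by
  obtain ⟨C, hC, R, hR, hlog⟩ := hG.power_law
  -- Grönwall starts at the top of the arc, where the contact-term hypothesis controls `G`. The
  -- other quarter follows by hermiticity.
  have hhalf : ∀ N, ∀ θ ∈ Set.Icc (Real.pi / 2) Real.pi,
      ‖G (circleMap 0 (R N) θ)‖ ≤ ‖G (R N * Complex.I)‖ * Real.exp (C * Real.pi) := by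
    intro N θ hθ
    have him : ∀ t ∈ Set.Icc (Real.pi / 2) Real.pi, 0 ≤ (circleMap 0 (R N) t).im := fun t ht =>
      circleMap_zero_im_nonneg (hR.pos N).le ⟨by linarith [ht.1, Real.pi_pos], ht.2⟩
    have h1 := norm_le_exp_mul_of_logDeriv_le (hR.pos N) (fun t ht => hG.retarded _ (him t ht))
      (fun t ht => hlog N _ (by simp [abs_of_pos (hR.pos N)]) (him t ht)) hθ
    have h2 : circleMap 0 (R N) (Real.pi / 2) = R N * Complex.I := by
      simp [circleMap, Complex.exp_pi_div_two_mul_I]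
    rw [h2] at h1
    refine h1.trans ?_
    gcongr
    linarith [hθ.2, Real.pi_pos]
  have hbound : ∀ N, ‖upperArcIntegral G (R N)‖ ≤
      ‖G (R N * Complex.I)‖ * Real.exp (C * Real.pi) * Real.pi := by
    intro N
    have h1 : ‖upperArcIntegral G (R N)‖ ≤
        ‖G (R N * Complex.I)‖ * Real.exp (C * Real.pi) * |Real.pi - 0| := by
      refine intervalIntegral.norm_integral_le_of_norm_le_const fun θ hθ => ?_
      rw [Set.uIoc_of_le Real.pi_pos.le] at hθ
      rcases le_total (Real.pi / 2) θ with h | h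
      · exact hhalf N θ ⟨h, hθ.2⟩
      · have h2 := hhalf N (Real.pi - θ) ⟨by linarith, by linarith [hθ.1]⟩
        rwa [circleMap_zero_pi_sub, ← hG.hermitian, RCLike.norm_conj] at h2
    rwa [sub_zero, abs_of_pos Real.pi_pos] at h1
  have hseq : Tendsto (fun N => upperArcIntegral G (R N)) atTop (𝓝 0) := by
    refine squeeze_zero_norm hbound ?_
    have h1 := ((hct.comp hR.tendsto).norm.mul_const (Real.exp (C * Real.pi))).mul_const Real.pi
    simpa using h1
  -- Truncating at `0` gives a function antitone on all of `ℝ`, whose limit may be read off along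
  -- the radii `R N`.
  have hanti : Antitone fun r => (upperArcIntegral G (max r 0)).re := fun r s hrs =>
    hG.antitoneOn_re_upperArcIntegral (le_max_right r 0) (le_max_right s 0)
      (max_le_max_right 0 hrs)
  have hre : Tendsto (fun r => (upperArcIntegral G (max r 0)).re) atTop (𝓝 0) := by
    rw [tendsto_iff_tendsto_subseq_of_antitone hanti hR.tendsto]
    have h1 := (Complex.continuous_re.tendsto 0).comp hseq
    refine h1.congr fun N => ?_
    simp [(hR.pos N).le]
  have hof := (Complex.continuous_ofReal.tendsto 0).comp hre
  rw [Complex.ofReal_zero] at hof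
  refine hof.congr' ?_
  filter_upwards [eventually_ge_atTop 0] with r hr
  simp only [Function.comp_apply, max_eq_left hr]
  exact Complex.conj_eq_iff_re.mp (hG.conj_upperArcIntegral r)

/-- The arc integral at radius `0` is `π G(0)`. If this vanished, a decreasing function with limit
`0` would start at `0`, hence be constant, and its derivative `-2 ρ(1)` at `1` would vanish. -/
theorem apply_zero_ne_zero (hG : IsThermalCorrelator β Δ d G) (hct : NoContactTerm G)
    (h1 : spectralDensity G 1 ≠ 0) : G 0 ≠ 0 := by
  intro h0
  have hlim := (Complex.continuous_re.tendsto 0).comp (hG.tendsto_upperArcIntegral hct)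
  have hI0 : upperArcIntegral G 0 = 0 := by simp [upperArcIntegral, circleMap_zero_radius, h0]
  have hanti := hG.antitoneOn_re_upperArcIntegral
  have hzero : ∀ r : ℝ, 0 ≤ r → (upperArcIntegral G r).re = 0 := by
    intro r hr
    refine le_antisymm ?_ ?_
    · have := hanti Set.self_mem_Ici hr hr
      simpa [hI0] using this
    · refine le_of_tendsto hlim ?_
      filter_upwards [eventually_ge_atTop r] with s hs
      exact hanti hr (hr.trans hs) hs
  have hd := hG.hasDerivAt_re_upperArcIntegral one_pos
  have hd0 : HasDerivAt (fun r => (upperArcIntegral G r).re) 0 1 := by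
    refine (hasDerivAt_const (1 : ℝ) (0 : ℝ)).congr_of_eventuallyEq ?_
    filter_upwards [eventually_gt_nhds one_pos] with r hr using hzero r hr.le
  have hre := hd.unique hd0
  have him : (spectralDensity G 1).im = 0 := by
    have h2 : (starRingEnd ℂ) (spectralDensity G 1) = spectralDensity G 1 := by
      have e1 := hG.hermitian 1
      have e2 := hG.hermitian (-1)
      simp only [map_neg, map_one, neg_neg] at e1 e2
      simp only [spectralDensity, map_div₀, map_sub, map_mul, Complex.conj_I, e1, e2,
        Complex.conj_ofNat]
      have hI := Complex.I_ne_zero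
      field_simp
      ring
    exact Complex.conj_eq_iff_im.mp h2
  refine h1 (Complex.ext ?_ him)
  simpa using hre

end IsThermalCorrelator

/-! ### The two sum rules -/

theorem mainTheorem11 (β Δ : ℝ) (d : ℕ) (hβ : 0 < β) (G : ℂ → ℂ)
    (hG : IsThermalCorrelator β Δ d G)
    (R : ℕ → ℝ) (hR : IsRadialSequence R) (hρ : PowerLawBoundedOn Δ d G R) :
    (∀ z ∈ spectrumOf G, Multipliable (mirrorFactor G z) ∧ mirrorProduct G z ≠ 0) ∧
    (2 * Δ - d < 1 →
      Tendsto (fun N : ℕ => ∑ᶠ z ∈ spectrumInDisc G (R N),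
          Complex.sinh (β * z / 2) / (z * mirrorProduct G z))
        atTop (𝓝 ((β : ℂ) / 2))) ∧
    (2 * Δ - d < 0 → NoContactTerm G →
      lambdaOf β G ≠ 0 ∧
      Tendsto (fun N : ℕ => ∑ᶠ z ∈ spectrumInDisc G (R N),
          Complex.sinh (β * z / 2) / mirrorProduct G z)
        atTop (𝓝 (Complex.I / lambdaOf β G))) := by
  classical
  obtain ⟨f, ⟨hf, hgrow⟩, hfρ, hf0⟩ := hG.thermal_product
  have hprod := fun a (ha : a ∈ spectrumOf G) =>
    IsThermalCorrelator.mirrorProduct_eq hG hβ hf hfρ hf0 (hgrow (1 / 2) (by norm_num)) ha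
  have hf00 := IsThermalCorrelator.apply_zero_mul_deriv_zero hG hf hfρ
  have hI := Complex.I_ne_zero
  have hβ' : (β : ℂ) ≠ 0 := by exact_mod_cast hβ.ne'
  have hG'0 : deriv G 0 ≠ 0 := fun h => by
    rw [h, mul_zero] at hf00
    exact div_ne_zero (mul_ne_zero hI hβ') two_ne_zero hf00.symm
  obtain ⟨A, hA, hρ⟩ := hρ
  have hB : ∀ N, ∀ ω : ℂ, ‖ω‖ = R N → ‖spectralDensity G ω‖ ≤ A * R N ^ (2 * Δ - d) :=
    fun N ω hω => (hρ N ω hω).le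
  choose! res hres0 hres using fun a (ha : a ∈ spectrumOf G) =>
    exists_residue_of_meromorphicOrderAt_eq_neg_one (hG.simple_poles a ha)
  -- Eliminating `deriv f a` between its product formula and its relation to the residue turns each
  -- summand into a residue.
  have hterm : ∀ a ∈ spectrumOf G, Complex.sinh (β * a / 2) / mirrorProduct G a =
      Complex.I * f 0 * (res a / a) := by
    intro a ha
    obtain ⟨-, hP, hd⟩ := hprod a ha
    have h1 := (IsThermalCorrelator.apply_eq_zero_and_deriv_mul_residue hG hf hfρ ha
      (hres0 a ha) (hres a ha)).2
    have ha0 := hG.ne_zero ha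
    have h2 : 2 * Complex.I * (Complex.sinh (β * a / 2) * a) =
        2 * Complex.I * (Complex.I * f 0 * res a * mirrorProduct G a) := by
      linear_combination (-a) * h1 + res a * hd - 2 * f 0 * res a * mirrorProduct G a * Complex.I_sq
    have h3 := mul_left_cancel₀ (mul_ne_zero two_ne_zero hI) h2
    field_simp
    linear_combination h3
  have hfin := fun N => spectrumInDisc_finite hG.meromorphic.meromorphicOn (R N)
  have hmem : ∀ N, ∀ a ∈ (hfin N).toFinset, a ∈ spectrumOf G ∧ ‖a‖ < R N := fun N a ha =>
    (hfin N).mem_toFinset.mp ha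
  -- The bound on `ρ` excludes poles on the circle itself, so the open disc accounts for every pole
  -- of the closed one.
  have hresidue := fun N => circleAverage_eq_add_sum_residues (hR.pos N) (P := (hfin N).toFinset)
    (res := res) (fun a ha => ⟨hG.ne_zero (hmem N a ha).1, by simpa using (hmem N a ha).2⟩)
    (fun a ha => hres a (hmem N a ha).1) (fun a _ => hG.eventually_analyticAt a)
    (fun z hz hzP => analyticAt_of_notMem_spectrumOf hG.meromorphic fun hzs => hzP <|
      (hfin N).mem_toFinset.mpr ⟨hzs, lt_of_le_of_ne (by simpa using hz)
        (hG.norm_ne_of_bounded (hR.pos N) (hB N) hzs)⟩)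
  refine ⟨fun z hz => ⟨(hprod z hz).1, (hprod z hz).2.1⟩, fun hp => ?_, fun hp hct => ?_⟩
  · have hcA : Tendsto (fun N => Real.circleAverage (fun z => G z / z) 0 (R N)) atTop (𝓝 0) := by
      refine squeeze_zero_norm
        (fun N => hG.norm_circleAverage_div_le (hR.pos N) (hB N)) ?_
      have h1 : Tendsto (fun x : ℝ => A * x ^ (-(1 - (2 * Δ - d)))) atTop (𝓝 (A * 0)) :=
        (tendsto_rpow_neg_atTop (by linarith)).const_mul A
      rw [mul_zero] at h1
      refine (h1.comp hR.tendsto).congr fun N => ?_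
      simp only [Function.comp_apply]
      rw [show -(1 - (2 * Δ - d)) = (2 * Δ - d) - 1 by ring, Real.rpow_sub_one (hR.pos N).ne',
        mul_div_assoc]
    have hlim := (hcA.sub_const (deriv G 0)).const_mul (Complex.I * f 0)
    have hval : Complex.I * f 0 * (0 - deriv G 0) = (β : ℂ) / 2 := by
      linear_combination (-Complex.I) * hf00 - (β : ℂ) / 2 * Complex.I_sq
    rw [hval] at hlim
    refine hlim.congr fun N => ?_
    rw [finsum_mem_eq_finite_toFinset_sum _ (hfin N), (hresidue N).2, add_sub_cancel_left,
      Finset.mul_sum]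
    refine Finset.sum_congr rfl fun a ha => ?_
    rw [mul_comm a, ← div_div, hterm a (hmem N a ha).1]
    ring
  · have hρ1 : spectralDensity G 1 ≠ 0 := fun h => by
      have h1 := IsThermalCorrelator.mul_spectralDensity_ofReal hG hfρ 1
      have h2 := IsThermalCorrelator.sinh_ne_zero hβ one_ne_zero
      rw [← h1, Complex.ofReal_one, h, mul_zero] at h2
      exact h2 rfl
    have hG0 := hG.apply_zero_ne_zero hct hρ1
    have hlam : lambdaOf β G ≠ 0 := by
      rw [lambdaOf, muOf]
      refine div_ne_zero (neg_ne_zero.mpr (div_ne_zero ?_ (mul_ne_zero hI hβ'))) hG0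
      exact mul_ne_zero two_ne_zero hG'0
    refine ⟨hlam, ?_⟩
    have herr : Tendsto (fun N => Real.pi * Real.circleAverage G 0 (R N) -
        upperArcIntegral G (R N)) atTop (𝓝 0) := by
      refine squeeze_zero_norm
        (fun N => hG.norm_pi_mul_circleAverage_sub_le (hR.pos N) (hB N)) ?_
      have h1 : Tendsto (fun x : ℝ => A * x ^ (-(-(2 * Δ - d))) * Real.pi) atTop
          (𝓝 (A * 0 * Real.pi)) :=
        ((tendsto_rpow_neg_atTop (by linarith)).const_mul A).mul_const _
      simp only [mul_zero, zero_mul, neg_neg] at h1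
      exact h1.comp hR.tendsto
    have hπ : (Real.pi : ℂ) ≠ 0 := by exact_mod_cast Real.pi_ne_zero
    -- Here `2Δ - d < 0` removes the error term, and the arc integral tends to `0` along every
    -- sequence of radii.
    have hcA : Tendsto (fun N => Real.circleAverage G 0 (R N)) atTop (𝓝 0) := by
      have h1 := (herr.add ((hG.tendsto_upperArcIntegral hct).comp hR.tendsto)).const_mul
        ((Real.pi : ℂ)⁻¹)
      simp only [add_zero, mul_zero] at h1
      refine h1.congr fun N => ?_
      simp only [Function.comp_apply, sub_add_cancel]
      field_simp
    have hlim := (hcA.sub_const (G 0)).const_mul (Complex.I * f 0)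
    have hval : Complex.I * f 0 * (0 - G 0) = Complex.I / lambdaOf β G := by
      rw [lambdaOf, muOf]
      field_simp
      linear_combination (-2 * G 0) * hf00
    rw [hval] at hlim
    refine hlim.congr fun N => ?_
    rw [finsum_mem_eq_finite_toFinset_sum _ (hfin N), (hresidue N).1, add_sub_cancel_left,
      Finset.mul_sum]
    exact Finset.sum_congr rfl fun a ha => (hterm a (hmem N a ha).1).symm
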